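/- **Corollary 2.3.** For $a,b\in\mathbb C$ let $\varphi_a(x)=x_+^a/\Gamma(a+1)$ and $\varphi_{a,b}(x)=x_+^a(1-x)_+^b/(\Gamma(a+1)\Gamma(b+1))$ be the standard (entire in the parameters) families of distributions on $\mathbb R$, and let $F\odot G$ denote the pseudoconvolution of distributions in two variables, $\langle F\odot G,f\rangle=\langle F(u,v)\otimes G(a,b),f(ua,vb)\rangle$. For $z,z'\in\mathbb C$ and $t=zz'$ let the distribution $N=N_{z,z'}$ on $\mathbb R^2$ be given by $$N(x,-y)=t\left(\varphi_{z'}(x)\varphi_{-z'}(y)e^{-x-y}\right)\odot\left(\varphi_{z,-z-1}(x)\varphi_{-z,z-1}(y)\right)\odot\left(\delta(x-y)\chi_{[0,1]}(x)\right).$$ Let $w(x,y)=\frac1{|x|+y}$ for $x<0<y$ and $w(x,y)=0$ otherwise, and put $N_{--}(x,y)=\int_{\mathbb R} w(-x,r)\,N(r,-y)\,dr$ for $x,y>0$. Let $W_{\kappa,\mu}$ be the Whittaker function. Suppose that $-1<\Re z<0$ and $-1<\Re z'<0$. Then the distribution $N$ is given by an integrable function on $\mathbb R^2$ that is continuous on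 $\{x>0>y\}$ and vanishes outside this quadrant; and for all $x,y>0$ the integral $\int_0^\infty\frac{N(r,-y)}{r+x}\,dr$ converges absolutely and $$N_{--}(x,y)=\int_0^\infty\frac{N(r,-y)}{r+x}\,dr=\frac{1}{\Gamma(-z)\Gamma(-z')}\left(\frac xy\right)^{\frac{z+z'}2}e^{\frac{x-y}2}(xy)^{-\frac12}$$ $$\times\ \frac{W_{\frac{-z-z'+1}2,\pm\frac{z-z'}2}(x)\,W_{\frac{-z-z'-1}2,\pm\frac{z-z'}2}(y)-W_{\frac{-z-z'-1}2,\pm\frac{z-z'}2}(x)\,W_{\frac{-z-z'+1}2,\pm\frac{z-z'}2}(y)}{x-y},$$ where each of the four signs $\pm$ may be chosen arbitrarily and, for $x=y$, the right-hand side is understood as its limit as $y\to x$, $y\ne x$ (which exists). Moreover, for fixed $x,y>0$, $x\neq y$, and any fixed choice of the signs, the right-hand side is a holomorphic function of $(z,z')\in\mathbb C^2$, so the formula gives the analytic continuation of $N_{--}(x,y)$ to all pairs $z,z'$. -/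

import Mathlib

open MeasureTheory Set Filter Topology
open scoped ContDiff

noncomputable section

namespace WhittakerKernel

/-- The value on `g` of the distribution `φ_a(x) = x₊ᵃ / Γ(a+1)` on the line, an entire family in
`a`. For `Re a > -1` (the case `k = 0`) it is an integrable density; in general it is defined by
`φ_a = (d/dx)ᵏ φ_{a+k}`, with `k` the least natural number such that `Re a + k > -1`. -/
def gammaPair (a : ℂ) (g : ℝ → ℂ) : ℂ :=
  let k : ℕ := ⌊-a.re⌋₊
  (-1) ^ k * ∫ x in Ioi (0 : ℝ), (x : ℂ) ^ (a + k) / Complex.Gamma (a + k + 1) * iteratedDeriv k g x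

/-- The value on `g` of the distribution `φ_{a,b}(x) = x₊ᵃ (1-x)₊ᵇ / (Γ(a+1) Γ(b+1))`, computed
from integrable densities by applying `k` times the rule
`φ_{a,b} = (a+b+2) φ_{a+1,b} + (b+1) φ'_{a+1,b+1}` and `m` times the rule
`φ_{a,b} = (a+b+2) φ_{a,b+1} - (a+1) φ'_{a+1,b+1}`. -/
def betaPairAux : ℕ → ℕ → ℂ → ℂ → (ℝ → ℂ) → ℂ
  | 0, 0, a, b, g =>
      ∫ x in Ioo (0 : ℝ) 1, (x : ℂ) ^ a * ((1 - x : ℝ) : ℂ) ^ b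
        / (Complex.Gamma (a + 1) * Complex.Gamma (b + 1)) * g x
  | 0, m + 1, a, b, g =>
      (a + b + 2) * betaPairAux 0 m a (b + 1) g
        + (a + 1) * betaPairAux 0 m (a + 1) (b + 1) (deriv g)
  | k + 1, m, a, b, g =>
      (a + b + 2) * betaPairAux k m (a + 1) b g
        - (b + 1) * betaPairAux k m (a + 1) (b + 1) (deriv g)

/-- The value on `g` of `φ_{a,b}(x) = x₊ᵃ (1-x)₊ᵇ / (Γ(a+1) Γ(b+1))`, an entire family in `(a, b)`
of distributions on the line. If `Re a > -1` and `Re b > -1`, this is just the integral of `g`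
against this integrable function. -/
def betaPair (a b : ℂ) (g : ℝ → ℂ) : ℂ :=
  betaPairAux ⌊-a.re⌋₊ ⌊-b.re⌋₊ a b g

/-- A generalized function of two variables `(x, y)`, given by its values on test functions. -/
abbrev GenFun2 := (ℝ → ℝ → ℂ) → ℂ

/-- The pseudoconvolution `F ⊙ G` (multiplicative convolution in each variable):
`⟨F ⊙ G, f⟩ = ⟨F(u,v) ⊗ G(a,b), f(ua, vb)⟩`. For functions it is
`(F ⊙ G)(x, y) = ∬ F(u,v) G(x/u, y/v) du dv / (uv)`; moments get multiplied. -/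
def pseudoConv (F G : GenFun2) : GenFun2 := fun f =>
  F fun u v => G fun a b => f (u * a) (v * b)

/-- `φ_{z'}(x) φ_{-z'}(y) e^{-x-y}`. -/
def gammaFactor (z' : ℂ) : GenFun2 := fun f =>
  gammaPair z' fun x => gammaPair (-z') fun y => Complex.exp (-(x : ℂ) - (y : ℂ)) * f x y

/-- `φ_{z,-z-1}(x) φ_{-z,z-1}(y)`. -/
def betaFactor (z : ℂ) : GenFun2 := fun f =>
  betaPair z (-z - 1) fun x => betaPair (-z) (z - 1) fun y => f x y

/-- `δ(x - y) χ_{[0,1]}(x)`. -/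
def diagFactor : GenFun2 := fun f => ∫ x in (0 : ℝ)..1, f x x

/-- The generalized function `N(x, y)`, defined by
`N(x,-y) = t (φ_{z'}(x) φ_{-z'}(y) e^{-x-y}) ⊙ (φ_{z,-z-1}(x) φ_{-z,z-1}(y)) ⊙ (δ(x-y) χ_{[0,1]}(x))`
with `t = z z'`. -/
def genN (z z' : ℂ) : GenFun2 := fun f =>
  z * z' * pseudoConv (pseudoConv (gammaFactor z') (betaFactor z)) diagFactor fun x y => f x (-y)

/-- The function `n` on the plane is (the) function representing the generalized function `N`: it is
integrable, continuous on the quadrant `x > 0 > y`, zero outside of it, and integrating against `n`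
gives the value of `N` on every smooth compactly supported function on the plane. These properties
determine `n` at every point. -/
structure RepresentsN (z z' : ℂ) (n : ℝ → ℝ → ℂ) : Prop where
  integrable : Integrable (fun p : ℝ × ℝ => n p.1 p.2)
  continuousOn : ContinuousOn (fun p : ℝ × ℝ => n p.1 p.2) (Ioi 0 ×ˢ Iio 0)
  eq_zero : ∀ x y : ℝ, x ≤ 0 ∨ 0 ≤ y → n x y = 0
  eq_integral : ∀ f : ℝ × ℝ → ℂ, ContDiff ℝ ∞ f → HasCompactSupport f →
    genN z z' (fun x y => f (x, y)) = ∫ p : ℝ × ℝ, n p.1 p.2 * f p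

/-- `w(x, y) = 1 / (|x| + y)` for `x < 0 < y`, and zero otherwise. -/
def w (x y : ℝ) : ℝ := if x < 0 ∧ 0 < y then 1 / (|x| + y) else 0

/-- The block `N₋₋(x, y) = Ñ(-x,-y) = ∫ w(-x, r) N(r, -y) dr`, for `x, y > 0`. -/
def blockMM (n : ℝ → ℝ → ℂ) (x y : ℝ) : ℂ := ∫ r : ℝ, (w (-x) r : ℂ) * n r (-y)

/-- The Whittaker function `W_{κ,μ}(x)`, `x > 0`, for arbitrary complex `κ`, `μ`:
`W_{κ,μ}(x) = e^{-x/2} x^{μ+1/2} ∫ φ_{μ-κ-1/2}(τ) (1+τ)^{μ+κ-1/2} e^{-τx} dτ`, that is,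
`e^{-x/2} x^{μ+1/2} Ψ(μ-κ+1/2, 2μ+1; x)`. -/
def whittakerW (κ μ : ℂ) (x : ℝ) : ℂ :=
  Complex.exp (-(x : ℂ) / 2) * (x : ℂ) ^ (μ + 1 / 2) *
    gammaPair (μ - κ - 1 / 2) fun τ =>
      ((1 + τ : ℝ) : ℂ) ^ (μ + κ - 1 / 2) * Complex.exp (-(τ : ℂ) * x)

/-- The closed formula for `N₋₋(x, y)` (for `x ≠ y`). The signs `s i` are those in front of
`(z-z')/2` in the second indices of the four Whittaker functions. -/
def formulaMM (s : Fin 4 → ℤˣ) (z z' : ℂ) (x y : ℝ) : ℂ :=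
  let μ : Fin 4 → ℂ := fun i => (((s i : ℤˣ) : ℤ) : ℂ) * ((z - z') / 2)
  1 / (Complex.Gamma (-z) * Complex.Gamma (-z'))
    * ((x / y : ℝ) : ℂ) ^ ((z + z') / 2) * Complex.exp (((x : ℂ) - y) / 2)
    * ((x * y : ℝ) : ℂ) ^ (-(1 / 2) : ℂ)
    * ((whittakerW ((-z - z' + 1) / 2) (μ 0) x * whittakerW ((-z - z' - 1) / 2) (μ 1) y
        - whittakerW ((-z - z' - 1) / 2) (μ 2) x * whittakerW ((-z - z' + 1) / 2) (μ 3) y)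
      / ((x : ℂ) - y))

end WhittakerKernel

end

/-! Everything is expressed through `kummerReg a b x`, the entire continuation in `(a, b)` of `∫
τᵃ(1+τ)ᵇe^{-τx} dτ / Γ(a+1)`. Integration by parts (`kummerReg_by_parts`) raises `a` by one, which
carries holomorphy and the derivative formula from `Re a > -1` to all `a`. The Kummer transformation
`cpow_mul_kummerReg_symm` shows that `W_{κ,μ}` is even in `μ`, so the four signs are immaterial.
With `1/Γ` entire this also gives the holomorphy statement.

For the density of `N`, a gamma weight convolved multiplicatively with a beta weight is again a
Laplace-type integral (`integral_gammaWeight_betaWeight`). In the first variable this is a genuine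
density `A`. In the second, the exponent `z-1` lies below `-1`; one regularisation puts a derivative
`∂_y(y·)` on the test function, and an integration by parts moves it back, replacing `solF` by `-y
solF' = solPsi`. The diagonal factor averages over dilations, so up to a constant `N(x,-y) = ∫ A(xT)
B(yT) dT` over `T > 1`, with `B = solPsi`.

The kernel `1/(r+x)` is homogeneous of degree `-1`, so the transform in `r` passes through the
dilation: it replaces `A` by its Stieltjes transform, which is a multiple of `solPhi`
(`integral_densityA_div`). Hence the block is a constant times `∫ Φ(xT)Ψ(yT) dT` over `T > 1`, where
`Φ = solPhi`, `Ψ = solPsi`.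

Finally `E = solE`, `Φ`, `F = solF`, `Ψ` satisfy first-order systems for which `d/dT [E(xT)F(yT) -
Φ(xT)Ψ(yT)] = -(x-y) Φ(xT)Ψ(yT)` (`hasDerivAt_bilinear`). Integrating from 1 to infinity gives the
quotient by `x - y`, and `formulaMM_eq` identifies it with the Whittaker expression. The integral
form is continuous in `y` also at `y = x`, which gives the limit on the diagonal. -/

noncomputable section

namespace WhittakerKernel

/-! ### The Laplace-type integral: bounds, derivative in `x`, holomorphy in the exponents. -/

/-- The integrand of the Laplace-type integral `∫ τᵃ (1+τ)ᵇ e^{-τx} dτ`. -/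
def kummerIntegrand (a b : ℂ) (x τ : ℝ) : ℂ :=
  (τ : ℂ) ^ a * (((1 + τ : ℝ) : ℂ) ^ b * Complex.exp (-(τ : ℂ) * x))

/-- The Laplace-type integral `∫ τᵃ (1+τ)ᵇ e^{-τx} dτ` over `τ > 0`. -/
def kummerInt (a b : ℂ) (x : ℝ) : ℂ := ∫ τ in Ioi (0 : ℝ), kummerIntegrand a b x τ

lemma norm_kummerIntegrand (a b : ℂ) (x : ℝ) {τ : ℝ} (hτ : 0 < τ) :
    ‖kummerIntegrand a b x τ‖ = τ ^ a.re * ((1 + τ) ^ b.re * Real.exp (-τ * x)) := by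
  rw [kummerIntegrand, norm_mul, norm_mul, Complex.norm_cpow_eq_rpow_re_of_pos hτ,
    Complex.norm_cpow_eq_rpow_re_of_pos (by positivity), Complex.norm_exp]
  simp

lemma exists_one_add_rpow_le_exp (b : ℝ) {ε : ℝ} (hε : 0 < ε) :
    ∃ C : ℝ, 0 ≤ C ∧ ∀ τ : ℝ, 0 ≤ τ → (1 + τ) ^ b ≤ C * Real.exp (ε * τ) := by
  obtain ⟨n, hn⟩ := exists_nat_ge b
  refine ⟨n.factorial / ε ^ n * Real.exp ε, by positivity, fun τ hτ => ?_⟩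
  have h1 : (1 + τ) ^ b ≤ (1 + τ) ^ n := by
    rw [← Real.rpow_natCast]
    exact Real.rpow_le_rpow_of_exponent_le (by linarith) hn
  have h2 := Real.pow_div_factorial_le_exp (ε * (1 + τ)) (by positivity) n
  rw [mul_pow, div_le_iff₀ (by positivity), mul_add, mul_one, Real.exp_add] at h2
  refine h1.trans ?_
  have : (1 + τ) ^ n = (ε ^ n * (1 + τ) ^ n) / ε ^ n := by field_simp
  rw [this, div_le_iff₀ (by positivity)]
  refine h2.trans (le_of_eq ?_)
  field_simp

lemma integrableOn_rpow_one_add_rpow_exp {a : ℝ} (ha : -1 < a) (b : ℝ) {x : ℝ} (hx : 0 < x) :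
    IntegrableOn (fun τ : ℝ => τ ^ a * ((1 + τ) ^ b * Real.exp (-τ * x))) (Ioi 0) := by
  obtain ⟨C, hC0, hC⟩ := exists_one_add_rpow_le_exp b (half_pos hx)
  have h := (integrableOn_rpow_mul_exp_neg_mul_rpow ha one_pos (half_pos hx)).const_mul C
  refine Integrable.mono' h (by fun_prop) ?_
  filter_upwards [ae_restrict_mem measurableSet_Ioi] with τ (hτ : 0 < τ)
  rw [Real.norm_of_nonneg (by positivity)]
  have h2 : Real.exp (-(x / 2) * τ ^ (1 : ℝ)) = Real.exp (x / 2 * τ) * Real.exp (-τ * x) := by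
    rw [← Real.exp_add, Real.rpow_one]; ring_nf
  rw [h2]
  have := mul_le_mul_of_nonneg_left (mul_le_mul_of_nonneg_right (hC τ hτ.le)
    (Real.exp_nonneg (-τ * x))) (Real.rpow_nonneg hτ.le a)
  linarith

lemma measurable_kummerIntegrand (a b : ℂ) (x : ℝ) : Measurable (kummerIntegrand a b x) := by
  unfold kummerIntegrand; fun_prop

lemma integrableOn_kummerIntegrand {a : ℂ} (ha : -1 < a.re) (b : ℂ) {x : ℝ} (hx : 0 < x) :
    IntegrableOn (kummerIntegrand a b x) (Ioi 0) := by
  refine Integrable.mono' (integrableOn_rpow_one_add_rpow_exp ha b.re hx)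
    (measurable_kummerIntegrand a b x).aestronglyMeasurable ?_
  filter_upwards [ae_restrict_mem measurableSet_Ioi] with τ hτ
  exact (norm_kummerIntegrand a b x hτ).le

lemma mul_kummerIntegrand (a b : ℂ) (x : ℝ) {τ : ℝ} (hτ : 0 < τ) :
    (τ : ℂ) * kummerIntegrand a b x τ = kummerIntegrand (a + 1) b x τ := by
  have : (τ : ℂ) ≠ 0 := by exact_mod_cast hτ.ne'
  rw [kummerIntegrand, kummerIntegrand, Complex.cpow_add _ _ this, Complex.cpow_one]
  ring

lemma kummerIntegrand_add_one (a b : ℂ) (x : ℝ) {τ : ℝ} (hτ : 0 < τ) :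
    kummerIntegrand a (b + 1) x τ = kummerIntegrand a b x τ + kummerIntegrand (a + 1) b x τ := by
  have : ((1 + τ : ℝ) : ℂ) ≠ 0 := by exact_mod_cast (by positivity : (1 + τ : ℝ) ≠ 0)
  rw [← mul_kummerIntegrand a b x hτ, kummerIntegrand, kummerIntegrand, Complex.cpow_add _ _ this,
    Complex.cpow_one]
  push_cast
  ring

lemma kummerInt_add_one {a : ℂ} (ha : -1 < a.re) (b : ℂ) {x : ℝ} (hx : 0 < x) :
    kummerInt a (b + 1) x = kummerInt a b x + kummerInt (a + 1) b x := by
  rw [kummerInt, kummerInt, kummerInt, ← integral_add (integrableOn_kummerIntegrand ha b hx)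
    (integrableOn_kummerIntegrand (by simp; linarith) b hx)]
  exact setIntegral_congr_fun measurableSet_Ioi fun τ hτ => kummerIntegrand_add_one a b x hτ

lemma hasDerivAt_kummerInt {a : ℂ} (ha : -1 < a.re) (b : ℂ) {x : ℝ} (hx : 0 < x) :
    HasDerivAt (kummerInt a b) (-kummerInt (a + 1) b x) x := by
  have ha' : -1 < (a + 1).re := by simp; linarith
  have h := hasDerivAt_integral_of_dominated_loc_of_deriv_le
    (μ := volume.restrict (Ioi (0 : ℝ))) (F := kummerIntegrand a b)
    (F' := fun x τ => -kummerIntegrand (a + 1) b x τ) (x₀ := x) (s := Ioi (x / 2))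
    (bound := fun τ => ‖kummerIntegrand (a + 1) b (x / 2) τ‖)
    (Ioi_mem_nhds (by linarith))
    (Eventually.of_forall fun x => (measurable_kummerIntegrand a b x).aestronglyMeasurable)
    (integrableOn_kummerIntegrand ha b hx)
    (measurable_kummerIntegrand (a + 1) b x).neg.aestronglyMeasurable ?_
    (integrableOn_kummerIntegrand ha' b (half_pos hx)).norm ?_
  · rw [kummerInt, ← integral_neg]; exact h.2
  · filter_upwards [ae_restrict_mem measurableSet_Ioi] with τ (hτ : 0 < τ) y (hy : x / 2 < y)
    rw [norm_neg, norm_kummerIntegrand _ _ _ hτ, norm_kummerIntegrand _ _ _ hτ]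
    gcongr ?_ * (?_ * Real.exp ?_)
    nlinarith
  · filter_upwards [ae_restrict_mem measurableSet_Ioi] with τ (hτ : 0 < τ) y _
    rw [← mul_kummerIntegrand a b y hτ]
    have h1 : HasDerivAt (fun y : ℝ => -(τ : ℂ) * y) (-(τ : ℂ)) y := by
      simpa using (Complex.ofRealCLM.hasDerivAt (x := y)).const_mul (-(τ : ℂ))
    refine ((h1.cexp.const_mul _).const_mul _).congr_deriv ?_
    unfold kummerIntegrand
    ring

/-- `‖∫ τᵃ (1+τ)ᵇ e^{-τx} dτ‖` is bounded for `x` away from zero. -/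
lemma exists_norm_kummerInt_le {a : ℂ} (ha : -1 < a.re) (b : ℂ) {ε : ℝ} (hε : 0 < ε) :
    ∃ C : ℝ, 0 ≤ C ∧ ∀ x : ℝ, ε ≤ x → ‖kummerInt a b x‖ ≤ C := by
  refine ⟨∫ τ in Ioi (0 : ℝ), ‖kummerIntegrand a b ε τ‖, by positivity, fun x hx => ?_⟩
  refine (norm_integral_le_integral_norm _).trans ?_
  refine setIntegral_mono_on (integrableOn_kummerIntegrand ha b (hε.trans_le hx)).norm
    (integrableOn_kummerIntegrand ha b hε).norm measurableSet_Ioi fun τ (hτ : 0 < τ) => ?_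
  rw [norm_kummerIntegrand _ _ _ hτ, norm_kummerIntegrand _ _ _ hτ]
  gcongr ?_ * (?_ * Real.exp ?_)
  nlinarith

/-- For `Re b ≤ 0` the factor `(1+τ)ᵇ` has norm at most 1, leaving a gamma integral. Unlike the
bound away from zero, this one controls the behaviour as `x → 0`. -/
lemma norm_kummerInt_le_rpow {a : ℂ} (ha : -1 < a.re) {b : ℂ} (hb : b.re ≤ 0) {x : ℝ}
    (hx : 0 < x) : ‖kummerInt a b x‖ ≤ Real.Gamma (a.re + 1) * x ^ (-a.re - 1) := by
  have h0 := Real.integral_rpow_mul_exp_neg_mul_Ioi (a := a.re + 1) (by linarith) hx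
  have h1 : Real.Gamma (a.re + 1) * x ^ (-a.re - 1)
      = ∫ τ in Ioi (0 : ℝ), τ ^ a.re * ((1 + τ) ^ (0 : ℝ) * Real.exp (-τ * x)) := by
    rw [one_div, Real.inv_rpow hx.le, ← Real.rpow_neg hx.le] at h0
    rw [show -a.re - 1 = -(a.re + 1) by ring, mul_comm, ← h0]
    refine setIntegral_congr_fun measurableSet_Ioi fun τ _ => ?_
    simp [mul_comm]
  rw [h1]
  refine (norm_integral_le_integral_norm _).trans ?_
  refine setIntegral_mono_on (integrableOn_kummerIntegrand ha b hx).norm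
    (integrableOn_rpow_one_add_rpow_exp ha 0 hx) measurableSet_Ioi fun τ (hτ : 0 < τ) => ?_
  rw [norm_kummerIntegrand _ _ _ hτ]
  gcongr
  linarith

/-- A majorant for differentiating in the exponents, which produces the factors `log τ` and
`log(1+τ)`. The variation of `a'` and the factor `log τ` each cost a power `τ^{±δ}`, while
`log(1+τ)` costs one power of `1+τ`; hence the exponents `a - 2δ`, `a`, `a + 2δ` and `b + 1`. -/
lemma norm_kummerIntegrand_mul_log_le {a : ℝ} {δ : ℝ} (hδ : 0 < δ) (b : ℝ) (x : ℝ)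
    {a' b' : ℂ} (ha1 : a - δ ≤ a'.re) (ha2 : a'.re ≤ a + δ) (hb : b'.re ≤ b) {τ : ℝ} (hτ : 0 < τ) :
    ‖kummerIntegrand a' b' x τ‖ * (|Real.log τ| + |Real.log (1 + τ)|) ≤
      (1 / δ + 1) * (τ ^ (a - 2 * δ) * ((1 + τ) ^ (b + 1) * Real.exp (-τ * x))
        + 2 * (τ ^ a * ((1 + τ) ^ (b + 1) * Real.exp (-τ * x)))
        + τ ^ (a + 2 * δ) * ((1 + τ) ^ (b + 1) * Real.exp (-τ * x))) := by
  have hpow : τ ^ a'.re ≤ τ ^ (a - δ) + τ ^ (a + δ) := by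
    rcases le_total τ 1 with h | h
    · have := Real.rpow_le_rpow_of_exponent_ge hτ h ha1
      have : 0 ≤ τ ^ (a + δ) := by positivity
      linarith
    · have := Real.rpow_le_rpow_of_exponent_le h ha2
      have : 0 ≤ τ ^ (a - δ) := by positivity
      linarith
  have hone : 1 ≤ τ ^ δ + τ ^ (-δ) := by
    rcases le_total τ 1 with h | h
    · have := Real.one_le_rpow_of_pos_of_le_one_of_nonpos hτ h (by linarith : -δ ≤ 0)
      have : 0 ≤ τ ^ δ := by positivity
      linarith
    · have := Real.one_le_rpow h hδ.le
      have : 0 ≤ τ ^ (-δ) := by positivity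
      linarith
  have hlog1 : |Real.log τ| ≤ (τ ^ δ + τ ^ (-δ)) / δ := by
    have h1 := Real.log_le_rpow_div hτ.le hδ
    have h2 := Real.log_le_rpow_div (inv_pos.2 hτ).le hδ
    rw [Real.log_inv, Real.inv_rpow hτ.le, ← Real.rpow_neg hτ.le] at h2
    have h3 : 0 ≤ τ ^ δ / δ := by positivity
    have h4 : 0 ≤ τ ^ (-δ) / δ := by positivity
    rw [add_div, abs_le]
    constructor <;> linarith
  have hlog2 : |Real.log (1 + τ)| ≤ 1 + τ := by
    rw [abs_of_nonneg (Real.log_nonneg (by linarith))]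
    exact (Real.log_le_self (by linarith))
  have hlog : |Real.log τ| + |Real.log (1 + τ)| ≤ (1 / δ + 1) * (τ ^ δ + τ ^ (-δ)) * (1 + τ) := by
    have h5 : (τ ^ δ + τ ^ (-δ)) / δ ≤ (τ ^ δ + τ ^ (-δ)) / δ * (1 + τ) :=
      le_mul_of_one_le_right (by positivity) (by linarith)
    have h6 : 1 + τ ≤ (τ ^ δ + τ ^ (-δ)) * (1 + τ) :=
      le_mul_of_one_le_left (by linarith) hone
    calc _ ≤ (τ ^ δ + τ ^ (-δ)) / δ * (1 + τ) + (τ ^ δ + τ ^ (-δ)) * (1 + τ) := by linarith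
      _ = _ := by ring
  have hb' : (1 + τ) ^ b'.re ≤ (1 + τ) ^ b :=
    Real.rpow_le_rpow_of_exponent_le (by linarith) hb
  rw [norm_kummerIntegrand _ _ _ hτ]
  calc _ ≤ ((τ ^ (a - δ) + τ ^ (a + δ)) * ((1 + τ) ^ b * Real.exp (-τ * x)))
        * ((1 / δ + 1) * (τ ^ δ + τ ^ (-δ)) * (1 + τ)) := by gcongr
    _ = (1 / δ + 1) * ((τ ^ (a - δ) * τ ^ (-δ) + (τ ^ (a - δ) * τ ^ δ + τ ^ (a + δ) * τ ^ (-δ))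
        + τ ^ (a + δ) * τ ^ δ) * ((1 + τ) ^ b * (1 + τ) * Real.exp (-τ * x))) := by ring
    _ = _ := by
      rw [← Real.rpow_add hτ, ← Real.rpow_add hτ, ← Real.rpow_add hτ, ← Real.rpow_add hτ,
        ← Real.rpow_add_one (by positivity : (1 + τ) ≠ 0)]
      rw [show a - δ + -δ = a - 2 * δ by ring, show a - δ + δ = a by ring,
        show a + δ + -δ = a by ring, show a + δ + δ = a + 2 * δ by ring]
      ring

lemma differentiableAt_kummerInt {p : ℂ × ℂ} (hp : -1 < p.1.re) {x : ℝ} (hx : 0 < x) :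
    DifferentiableAt ℂ (fun q : ℂ × ℂ => kummerInt q.1 q.2 x) p := by
  -- A quarter of the distance to the line `Re a = -1`, so that the worst exponent `Re a - 2δ` of
  -- the majorant is still above `-1`.
  set δ : ℝ := (p.1.re + 1) / 4 with hδdef
  have hδ : 0 < δ := by rw [hδdef]; linarith
  have hmeas : ∀ q : ℂ × ℂ, AEStronglyMeasurable (kummerIntegrand q.1 q.2 x)
      (volume.restrict (Ioi (0 : ℝ))) := fun q =>
    (measurable_kummerIntegrand q.1 q.2 x).aestronglyMeasurable
  have hlin : Measurable fun τ : ℝ => (Complex.log τ • ContinuousLinearMap.fst ℂ ℂ ℂ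
      + Complex.log ((1 + τ : ℝ) : ℂ) • ContinuousLinearMap.snd ℂ ℂ ℂ) := by
    refine Measurable.add ?_ ?_ <;> refine Measurable.smul_const ?_ _ <;> fun_prop
  have h := hasFDerivAt_integral_of_dominated_of_fderiv_le (𝕜 := ℂ)
    (μ := volume.restrict (Ioi (0 : ℝ)))
    (F := fun q : ℂ × ℂ => kummerIntegrand q.1 q.2 x)
    (F' := fun q τ => kummerIntegrand q.1 q.2 x τ • (Complex.log τ • ContinuousLinearMap.fst ℂ ℂ ℂ
      + Complex.log ((1 + τ : ℝ) : ℂ) • ContinuousLinearMap.snd ℂ ℂ ℂ)) (x₀ := p)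
    (s := Metric.ball p δ) (Metric.ball_mem_nhds p hδ)
    (Eventually.of_forall hmeas) (integrableOn_kummerIntegrand hp p.2 hx)
    ((measurable_kummerIntegrand p.1 p.2 x).smul hlin).aestronglyMeasurable
    (bound := fun τ => (1 / δ + 1) *
      (τ ^ (p.1.re - 2 * δ) * ((1 + τ) ^ (p.2.re + δ + 1) * Real.exp (-τ * x))
        + 2 * (τ ^ p.1.re * ((1 + τ) ^ (p.2.re + δ + 1) * Real.exp (-τ * x)))
        + τ ^ (p.1.re + 2 * δ) * ((1 + τ) ^ (p.2.re + δ + 1) * Real.exp (-τ * x)))) ?_ ?_ ?_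
  · exact h.differentiableAt
  · filter_upwards [ae_restrict_mem measurableSet_Ioi] with τ (hτ : 0 < τ) q hq
    rw [mem_ball_iff_norm] at hq
    have h1 : |q.1.re - p.1.re| ≤ δ := by
      rw [← Complex.sub_re]
      exact (Complex.abs_re_le_norm _).trans ((norm_fst_le (q - p)).trans hq.le)
    have h2 : |q.2.re - p.2.re| ≤ δ := by
      rw [← Complex.sub_re]
      exact (Complex.abs_re_le_norm _).trans ((norm_snd_le (q - p)).trans hq.le)
    rw [abs_le] at h1 h2
    refine le_trans ?_ (norm_kummerIntegrand_mul_log_le hδ (p.2.re + δ) x (a := p.1.re)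
      (a' := q.1) (b' := q.2) (by linarith) (by linarith) (by linarith) hτ)
    rw [norm_smul]
    gcongr
    refine (norm_add_le _ _).trans ?_
    rw [norm_smul, norm_smul, ← Complex.ofReal_log hτ.le, ← Complex.ofReal_log (by positivity),
      Complex.norm_real, Complex.norm_real, Real.norm_eq_abs, Real.norm_eq_abs]
    gcongr
    · exact mul_le_of_le_one_right (abs_nonneg _) (ContinuousLinearMap.norm_fst_le ..)
    · exact mul_le_of_le_one_right (abs_nonneg _) (ContinuousLinearMap.norm_snd_le ..)
  · refine Integrable.const_mul (((integrableOn_rpow_one_add_rpow_exp ?_ _ hx).add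
      ((integrableOn_rpow_one_add_rpow_exp hp _ hx).const_mul 2)).add
      (integrableOn_rpow_one_add_rpow_exp ?_ _ hx)) _ <;> linarith
  · filter_upwards [ae_restrict_mem measurableSet_Ioi] with τ (hτ : 0 < τ) q _
    have hτ' : (τ : ℂ) ≠ 0 := by exact_mod_cast hτ.ne'
    have hτ1 : ((1 + τ : ℝ) : ℂ) ≠ 0 := by exact_mod_cast (by positivity : (1 + τ : ℝ) ≠ 0)
    have e1 := (hasFDerivAt_fst (𝕜 := ℂ) (p := q)).const_cpow (c := (τ : ℂ)) (Or.inl hτ')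
    have e2 := (hasFDerivAt_snd (𝕜 := ℂ) (p := q)).const_cpow (c := ((1 + τ : ℝ) : ℂ)) (Or.inl hτ1)
    refine (e1.mul (e2.mul_const (Complex.exp (-(τ : ℂ) * x)))).congr_fderiv ?_
    ext <;> simp [kummerIntegrand] <;> ring

/-! ### The entire continuation in the parameters. -/

/-- The test function in the integral representation of the Whittaker function. -/
def kummerTest (b : ℂ) (x τ : ℝ) : ℂ := ((1 + τ : ℝ) : ℂ) ^ b * Complex.exp (-(τ : ℂ) * x)

/-- The entire continuation in `(a, b)` of `∫ τᵃ (1+τ)ᵇ e^{-τx} dτ / Γ(a+1)`; it is equal to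
`Ψ(a+1, a+b+2; x)`. -/
def kummerReg (a b : ℂ) (x : ℝ) : ℂ := gammaPair a (kummerTest b x)

lemma whittakerW_eq_kummerReg (κ μ : ℂ) (x : ℝ) :
    whittakerW κ μ x = Complex.exp (-(x : ℂ) / 2) * (x : ℂ) ^ (μ + 1 / 2) *
      kummerReg (μ - κ - 1 / 2) (μ + κ - 1 / 2) x := rfl

lemma gammaPair_of_neg_one_lt {a : ℂ} (ha : -1 < a.re) (g : ℝ → ℂ) :
    gammaPair a g = (Complex.Gamma (a + 1))⁻¹ * ∫ x in Ioi (0 : ℝ), (x : ℂ) ^ a * g x := by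
  have hk : ⌊-a.re⌋₊ = 0 := Nat.floor_eq_zero.2 (by linarith)
  simp only [gammaPair, hk, pow_zero, one_mul, Nat.cast_zero, add_zero, iteratedDeriv_zero]
  rw [← integral_const_mul]
  refine integral_congr_ae (Eventually.of_forall fun x => ?_)
  dsimp only
  ring

/-- The floor fixing the number of derivatives drops by exactly one under `a ↦ a + 1`. Below `Re a =
-1` the recursion for `kummerReg` is therefore built into the definition. -/
lemma gammaPair_eq_neg_deriv {a : ℂ} (ha : a.re ≤ -1) (g : ℝ → ℂ) :
    gammaPair a g = -gammaPair (a + 1) (deriv g) := by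
  have hk : ⌊-a.re⌋₊ = ⌊-(a + 1).re⌋₊ + 1 := by
    have h : -a.re = -(a + 1).re + 1 := by simp
    rw [h, Nat.floor_add_one (by simp; linarith)]
  simp only [gammaPair, hk, pow_succ, iteratedDeriv_succ']
  push_cast
  rw [← neg_mul]
  congr 1
  · ring
  · congr 1
    ext x
    rw [show a + ((⌊-(a + 1).re⌋₊ : ℂ) + 1) = a + 1 + ⌊-(a + 1).re⌋₊ by ring]

lemma kummerReg_of_neg_one_lt {a : ℂ} (ha : -1 < a.re) (b : ℂ) (x : ℝ) :
    kummerReg a b x = (Complex.Gamma (a + 1))⁻¹ * kummerInt a b x :=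
  gammaPair_of_neg_one_lt ha _

lemma hasDerivAt_ofReal_cpow_of_pos (r : ℂ) {x : ℝ} (hx : 0 < x) :
    HasDerivAt (fun y : ℝ => (y : ℂ) ^ r) (r * (x : ℂ) ^ (r - 1)) x := by
  rcases eq_or_ne r 0 with rfl | hr
  · simpa using hasDerivAt_const x (1 : ℂ)
  · exact hasDerivAt_ofReal_cpow_const hx.ne' hr

lemma hasDerivAt_kummerTest (b : ℂ) (x : ℝ) {τ : ℝ} (hτ : -1 < τ) :
    HasDerivAt (kummerTest b x) (b * kummerTest (b - 1) x τ - x * kummerTest b x τ) τ := by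
  have h1 : HasDerivAt (fun y : ℝ => ((1 + y : ℝ) : ℂ) ^ b)
      (b * ((1 + τ : ℝ) : ℂ) ^ (b - 1)) τ := by
    have := (hasDerivAt_ofReal_cpow_of_pos b (by linarith : 0 < 1 + τ)).scomp τ
      ((hasDerivAt_id τ).const_add 1)
    simpa [Function.comp_def] using this
  have h2 : HasDerivAt (fun y : ℝ => -(y : ℂ) * x) (-(x : ℂ)) τ := by
    simpa using ((Complex.ofRealCLM.hasDerivAt (x := τ)).neg.mul_const (x : ℂ))
  refine (h1.mul h2.cexp).congr_deriv ?_
  unfold kummerTest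
  ring

lemma contDiffAt_kummerTest (b : ℂ) (x : ℝ) {τ : ℝ} (hτ : -1 < τ) {n : WithTop ℕ∞} :
    ContDiffAt ℝ n (kummerTest b x) τ := by
  have h : kummerTest b x =ᶠ[𝓝 τ] fun y : ℝ =>
      Complex.exp (Complex.ofRealCLM (Real.log (1 + y)) * b)
        * Complex.exp (-(Complex.ofRealCLM y) * x) := by
    filter_upwards [Ioi_mem_nhds hτ] with y (hy : -1 < y)
    have : ((1 + y : ℝ) : ℂ) ≠ 0 := by exact_mod_cast (by linarith : (1 + y : ℝ) ≠ 0)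
    rw [kummerTest, Complex.cpow_def_of_ne_zero this, ← Complex.ofReal_log (by linarith)]
    rfl
  refine ContDiffAt.congr_of_eventuallyEq ?_ h
  have hlog : ContDiffAt ℝ n (fun y : ℝ => Real.log (1 + y)) τ :=
    (contDiffAt_const.add contDiffAt_id).log (by simp; linarith)
  refine ContDiffAt.mul (ContDiffAt.cexp ?_) (ContDiffAt.cexp ?_)
  · exact (Complex.ofRealCLM.contDiff.contDiffAt.comp τ hlog).mul contDiffAt_const
  · exact Complex.ofRealCLM.contDiff.contDiffAt.neg.mul contDiffAt_const

lemma measurable_iteratedDeriv_kummerTest (k : ℕ) (b : ℂ) (x : ℝ) :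
    Measurable (iteratedDeriv k (kummerTest b x)) := by
  cases k with
  | zero => rw [iteratedDeriv_zero]; unfold kummerTest; fun_prop
  | succ k => rw [iteratedDeriv_succ]; exact measurable_deriv _

lemma iteratedDeriv_kummerTest_comb (k : ℕ) (c₁ c₂ b₁ b₂ : ℂ) (x : ℝ) {τ : ℝ} (hτ : -1 < τ) :
    iteratedDeriv k (fun t => c₁ * kummerTest b₁ x t - c₂ * kummerTest b₂ x t) τ =
      c₁ * iteratedDeriv k (kummerTest b₁ x) τ - c₂ * iteratedDeriv k (kummerTest b₂ x) τ := by
  rw [iteratedDeriv_fun_sub (contDiffAt_const.mul (contDiffAt_kummerTest b₁ x hτ))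
    (contDiffAt_const.mul (contDiffAt_kummerTest b₂ x hτ)),
    iteratedDeriv_const_mul_field, iteratedDeriv_const_mul_field]

lemma iteratedDeriv_deriv_kummerTest (k : ℕ) (b : ℂ) (x : ℝ) {τ : ℝ} (hτ : -1 < τ) :
    iteratedDeriv k (deriv (kummerTest b x)) τ =
      b * iteratedDeriv k (kummerTest (b - 1) x) τ - x * iteratedDeriv k (kummerTest b x) τ := by
  rw [← iteratedDeriv_kummerTest_comb k b x (b - 1) b x hτ]
  refine Filter.EventuallyEq.iteratedDeriv_eq k ?_
  filter_upwards [Ioi_mem_nhds hτ] with y hy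
  exact (hasDerivAt_kummerTest b x hy).deriv

/-- Differentiation keeps the test functions in the span of the family with `b` lowered, so the
induction on `k` needs `b` free. Half of the decay rate is given up to absorb the power of `1+τ`. -/
lemma exists_norm_iteratedDeriv_kummerTest_le (k : ℕ) {x : ℝ} (hx : 0 < x) : ∀ b : ℂ,
    ∃ C : ℝ, ∀ τ : ℝ, 0 < τ → ‖iteratedDeriv k (kummerTest b x) τ‖
      ≤ C * Real.exp (-(x / 2) * τ) := by
  induction k with
  | zero =>
    intro b
    obtain ⟨C, hC0, hC⟩ := exists_one_add_rpow_le_exp b.re (half_pos hx)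
    refine ⟨C, fun τ hτ => ?_⟩
    rw [iteratedDeriv_zero, kummerTest, norm_mul,
      Complex.norm_cpow_eq_rpow_re_of_pos (by positivity),
      Complex.norm_exp]
    have h1 : (-(τ : ℂ) * x).re = -τ * x := by simp
    have h2 : Real.exp (-(x / 2) * τ) = Real.exp (x / 2 * τ) * Real.exp (-τ * x) := by
      rw [← Real.exp_add]; ring_nf
    rw [h1, h2, ← mul_assoc]
    exact mul_le_mul_of_nonneg_right (hC τ hτ.le) (Real.exp_nonneg _)
  | succ k ih =>
    intro b
    obtain ⟨C₁, h₁⟩ := ih (b - 1)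
    obtain ⟨C₂, h₂⟩ := ih b
    refine ⟨‖b‖ * C₁ + x * C₂, fun τ hτ => ?_⟩
    rw [iteratedDeriv_succ', iteratedDeriv_deriv_kummerTest k b x (by linarith)]
    refine (norm_sub_le _ _).trans ?_
    rw [norm_mul, norm_mul, Complex.norm_real, Real.norm_of_nonneg hx.le, add_mul, mul_assoc,
      mul_assoc]
    have := h₁ τ hτ
    have := h₂ τ hτ
    gcongr

lemma integrableOn_cpow_mul_iteratedDeriv_kummerTest {s : ℂ} (hs : -1 < s.re) (k : ℕ) (b : ℂ)
    {x : ℝ} (hx : 0 < x) :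
    IntegrableOn (fun τ : ℝ => (τ : ℂ) ^ s * iteratedDeriv k (kummerTest b x) τ) (Ioi 0) := by
  obtain ⟨C, hC⟩ := exists_norm_iteratedDeriv_kummerTest_le k hx b
  have h := (integrableOn_rpow_mul_exp_neg_mul_rpow hs one_pos (half_pos hx)).const_mul C
  have hm := measurable_iteratedDeriv_kummerTest k b x
  refine Integrable.mono' h (by fun_prop) ?_
  filter_upwards [ae_restrict_mem measurableSet_Ioi] with τ (hτ : 0 < τ)
  rw [norm_mul, Complex.norm_cpow_eq_rpow_re_of_pos hτ, Real.rpow_one, mul_left_comm]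
  exact mul_le_mul_of_nonneg_left (hC τ hτ) (by positivity)

lemma gammaPair_deriv_kummerTest (a b : ℂ) {x : ℝ} (hx : 0 < x) :
    gammaPair a (deriv (kummerTest b x)) = b * kummerReg a (b - 1) x - x * kummerReg a b x := by
  set k := ⌊-a.re⌋₊ with hk
  have hs : -1 < (a + k).re := by
    have := Nat.lt_floor_add_one (-a.re)
    rw [Complex.add_re, Complex.natCast_re]
    linarith
  simp only [kummerReg, gammaPair, ← hk]
  have e : ∀ g : ℝ → ℂ, ∫ y in Ioi (0 : ℝ), (y : ℂ) ^ (a + k) / Complex.Gamma (a + k + 1) * g y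
      = (Complex.Gamma (a + k + 1))⁻¹ * ∫ y in Ioi (0 : ℝ), (y : ℂ) ^ (a + k) * g y := by
    intro g
    rw [← integral_const_mul]
    congr 1
    ext y
    ring
  rw [e, e, e]
  have h : ∫ y in Ioi (0 : ℝ), (y : ℂ) ^ (a + k) * iteratedDeriv k (deriv (kummerTest b x)) y
      = b * (∫ y in Ioi (0 : ℝ), (y : ℂ) ^ (a + k) * iteratedDeriv k (kummerTest (b - 1) x) y)
        - x * ∫ y in Ioi (0 : ℝ), (y : ℂ) ^ (a + k) * iteratedDeriv k (kummerTest b x) y := by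
    rw [← integral_const_mul, ← integral_const_mul, ← integral_sub
      ((integrableOn_cpow_mul_iteratedDeriv_kummerTest hs k (b - 1) hx).const_mul b)
      ((integrableOn_cpow_mul_iteratedDeriv_kummerTest hs k b hx).const_mul (x : ℂ))]
    refine setIntegral_congr_fun measurableSet_Ioi fun y (hy : 0 < y) => ?_
    rw [iteratedDeriv_deriv_kummerTest k b x (by linarith)]
    ring
  rw [h]
  ring

lemma kummerInt_by_parts {a : ℂ} (ha : -1 < a.re) (b : ℂ) {x : ℝ} (hx : 0 < x) :
    (a + 1) * kummerInt a b x = x * kummerInt (a + 1) b x - b * kummerInt (a + 1) (b - 1) x := by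
  have ha' : -1 < (a + 1).re := by simp; linarith
  have ha0 : a + 1 ≠ 0 := fun h => by
    have := congrArg Complex.re h
    simp at this; linarith
  have hd : ∀ τ ∈ Ioi (0 : ℝ), HasDerivAt (kummerIntegrand (a + 1) b x)
      ((a + 1) * kummerIntegrand a b x τ - (x * kummerIntegrand (a + 1) b x τ
        - b * kummerIntegrand (a + 1) (b - 1) x τ)) τ := by
    intro τ (hτ : 0 < τ)
    have h1 := (hasDerivAt_ofReal_cpow_of_pos (a + 1) hτ).mul
      (hasDerivAt_kummerTest b x (by linarith : -1 < τ))
    refine h1.congr_deriv ?_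
    simp only [kummerIntegrand, kummerTest, add_sub_cancel_right]
    ring
  have i1 := (integrableOn_kummerIntegrand ha b hx).const_mul (a + 1)
  have i2 := (integrableOn_kummerIntegrand ha' b hx).const_mul (x : ℂ)
  have i3 := (integrableOn_kummerIntegrand ha' (b - 1) hx).const_mul b
  have i0 := i1.sub (i2.sub i3)
  -- The boundary term at infinity vanishes because the function and its derivative are both
  -- integrable; the one at 0 vanishes because `Re (a+1) > 0`.
  have htop := tendsto_zero_of_hasDerivAt_of_integrableOn_Ioi hd i0
    (integrableOn_kummerIntegrand ha' b hx)
  have hcont : ContinuousWithinAt (kummerIntegrand (a + 1) b x) (Ici 0) 0 := by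
    have hc : ContinuousAt (fun τ : ℝ => (τ : ℂ) ^ (a + 1)) 0 :=
      Complex.continuousAt_ofReal_cpow_const 0 (a + 1) (Or.inl (by simp; linarith))
    exact (hc.mul (hasDerivAt_kummerTest b x (by linarith : (-1 : ℝ) < 0)).continuousAt
      ).continuousWithinAt
  have h := integral_Ioi_of_hasDerivAt_of_tendsto hcont hd i0 htop
  have hz : kummerIntegrand (a + 1) b x 0 = 0 := by
    simp [kummerIntegrand, Complex.zero_cpow ha0]
  rw [hz, sub_zero, integral_sub i1 (g := fun τ => x * kummerIntegrand (a + 1) b x τ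
    - b * kummerIntegrand (a + 1) (b - 1) x τ) (i2.sub i3), integral_sub i2 i3,
    integral_const_mul, integral_const_mul, integral_const_mul] at h
  exact sub_eq_zero.1 h

/-- True integration by parts for `Re a > -1`, and the defining rule `φ_a = φ'_{a+1}` otherwise.
Only `a + 1` occurs on the right, so properties known on a half-plane extend one unit further to the
left. -/
lemma kummerReg_by_parts (a b : ℂ) {x : ℝ} (hx : 0 < x) :
    kummerReg a b x = x * kummerReg (a + 1) b x - b * kummerReg (a + 1) (b - 1) x := by
  rcases le_or_gt a.re (-1) with ha | ha
  · rw [kummerReg, gammaPair_eq_neg_deriv ha, gammaPair_deriv_kummerTest _ _ hx]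
    ring
  · have ha' : -1 < (a + 1).re := by simp; linarith
    have ha0 : a + 1 ≠ 0 := fun h => by
      have := congrArg Complex.re h
      simp at this; linarith
    have hG : Complex.Gamma (a + 1) ≠ 0 := Complex.Gamma_ne_zero_of_re_pos (by simp; linarith)
    rw [kummerReg_of_neg_one_lt ha, kummerReg_of_neg_one_lt ha', kummerReg_of_neg_one_lt ha',
      Complex.Gamma_add_one _ ha0]
    have h := kummerInt_by_parts ha b hx
    field_simp
    linear_combination h

lemma differentiable_kummerReg {x : ℝ} (hx : 0 < x) :
    Differentiable ℂ (fun p : ℂ × ℂ => kummerReg p.1 p.2 x) := by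
  -- Induction over the half-planes `Re a > -n - 1`, which exhaust the plane.
  have key : ∀ n : ℕ, ∀ p : ℂ × ℂ, -(n : ℝ) - 1 < p.1.re →
      DifferentiableAt ℂ (fun q : ℂ × ℂ => kummerReg q.1 q.2 x) p := by
    intro n
    induction n with
    | zero =>
      intro p hp
      have hp' : -1 < p.1.re := by simpa using hp
      have h : (fun q : ℂ × ℂ => kummerReg q.1 q.2 x) =ᶠ[𝓝 p]
          fun q => (Complex.Gamma (q.1 + 1))⁻¹ * kummerInt q.1 q.2 x := by
        have : ∀ᶠ q : ℂ × ℂ in 𝓝 p, -1 < q.1.re :=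
          (Complex.continuous_re.comp continuous_fst).continuousAt.eventually_const_lt hp'
        filter_upwards [this] with q hq
        exact kummerReg_of_neg_one_lt hq _ _
      refine DifferentiableAt.congr_of_eventuallyEq ?_ h
      refine DifferentiableAt.mul ?_ (differentiableAt_kummerInt hp' hx)
      exact DifferentiableAt.comp (f := fun q : ℂ × ℂ => q.1 + 1) p
        (Complex.differentiable_one_div_Gamma (p.1 + 1)) (by fun_prop)
    | succ n ih =>
      intro p hp
      have hp' : -(n : ℝ) - 1 < (p.1 + 1).re := by
        push_cast at hp
        simp only [Complex.add_re, Complex.one_re]; linarith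
      have h : (fun q : ℂ × ℂ => kummerReg q.1 q.2 x) =
          fun q => x * kummerReg (q.1 + 1) q.2 x - q.2 * kummerReg (q.1 + 1) (q.2 - 1) x := by
        ext q
        exact kummerReg_by_parts q.1 q.2 hx
      rw [h]
      have h1 : DifferentiableAt ℂ (fun q : ℂ × ℂ => kummerReg (q.1 + 1) q.2 x) p :=
        (ih (p.1 + 1, p.2) hp').comp (f := fun q : ℂ × ℂ => (q.1 + 1, q.2)) p (by fun_prop)
      have h2 : DifferentiableAt ℂ (fun q : ℂ × ℂ => kummerReg (q.1 + 1) (q.2 - 1) x) p :=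
        (ih (p.1 + 1, p.2 - 1) hp').comp (f := fun q : ℂ × ℂ => (q.1 + 1, q.2 - 1)) p (by fun_prop)
      exact (h1.const_mul _).sub (differentiableAt_snd.mul h2)
  intro p
  obtain ⟨n, hn⟩ := exists_nat_gt (-p.1.re - 1)
  exact key n p (by linarith)

/-! ### The Kummer transformation and the Whittaker functions. -/

/-- The Laplace-type integral as a double integral that is symmetric in the two exponents. -/
lemma kummerInt_mul_Gamma {a b : ℂ} (hb : -1 < b.re) {x : ℝ} (hx : 0 < x) :
    kummerInt a (-b - 1) x * Complex.Gamma (b + 1) = (x : ℂ) ^ (b + 1) *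
      ∫ τ in Ioi (0 : ℝ), ∫ s in Ioi (0 : ℝ),
        (τ : ℂ) ^ a * (s : ℂ) ^ b * Complex.exp (-(x * (τ + s + τ * s))) := by
  rw [kummerInt, ← integral_mul_const, ← integral_const_mul]
  refine setIntegral_congr_fun measurableSet_Ioi fun τ (hτ : 0 < τ) => ?_
  have hr : 0 < x * (1 + τ) := by positivity
  have h := Complex.integral_cpow_mul_exp_neg_mul_Ioi (a := b + 1) (r := x * (1 + τ))
    (by simp; linarith) hr
  have h2 : ∫ s in Ioi (0 : ℝ), (τ : ℂ) ^ a * (s : ℂ) ^ b * Complex.exp (-(x * (τ + s + τ * s)))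
      = (τ : ℂ) ^ a * Complex.exp (-(τ : ℂ) * x) * ∫ s in Ioi (0 : ℝ), (s : ℂ) ^ (b + 1 - 1) *
        Complex.exp (-(((x * (1 + τ) : ℝ) : ℂ) * s)) := by
    rw [← integral_const_mul]
    refine setIntegral_congr_fun measurableSet_Ioi fun s _ => ?_
    rw [add_sub_cancel_right, show -((x : ℂ) * (τ + s + τ * s))
      = -(τ : ℂ) * x + -(((x * (1 + τ) : ℝ) : ℂ) * s) by push_cast; ring, Complex.exp_add]
    ring
  rw [h2, h, kummerIntegrand, one_div, ← Complex.ofReal_inv, mul_inv, Complex.ofReal_mul,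
    Complex.mul_cpow_ofReal_nonneg (by positivity) (by positivity), Complex.ofReal_inv,
    Complex.ofReal_inv, Complex.inv_cpow _ _ (Complex.arg_ofReal_of_nonneg hx.le ▸ Real.pi_pos.ne),
    Complex.inv_cpow _ _ (Complex.arg_ofReal_of_nonneg (by linarith : 0 ≤ 1 + τ) ▸
      Real.pi_pos.ne),
    show -b - 1 = -(b + 1) by ring, Complex.cpow_neg]
  have : (x : ℂ) ^ (b + 1) ≠ 0 := by
    simp [Complex.cpow_eq_zero_iff, hx.ne']
  field_simp

lemma integrable_kummer_double {a b : ℂ} (ha : -1 < a.re) (hb : -1 < b.re) {x : ℝ} (hx : 0 < x) :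
    Integrable (fun p : ℝ × ℝ => (p.1 : ℂ) ^ a * (p.2 : ℂ) ^ b *
      Complex.exp (-(x * (p.1 + p.2 + p.1 * p.2))))
      ((volume.restrict (Ioi 0)).prod (volume.restrict (Ioi 0))) := by
  have h := (integrableOn_kummerIntegrand ha 0 hx).mul_prod (integrableOn_kummerIntegrand hb 0 hx)
  refine h.mono (by fun_prop) ?_
  rw [Measure.prod_restrict]
  filter_upwards [ae_restrict_mem (measurableSet_Ioi.prod measurableSet_Ioi)] with p hp
  have h1 : 0 < p.1 := hp.1
  have h2 : 0 < p.2 := hp.2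
  rw [norm_mul, norm_mul, norm_mul, norm_kummerIntegrand _ _ _ h1, norm_kummerIntegrand _ _ _ h2,
    Complex.norm_cpow_eq_rpow_re_of_pos h1, Complex.norm_cpow_eq_rpow_re_of_pos h2,
    Complex.norm_exp]
  have h3 : (-((x : ℂ) * (p.1 + p.2 + p.1 * p.2))).re = -(x * (p.1 + p.2 + p.1 * p.2)) := by
    simp
  rw [h3, Complex.zero_re, Real.rpow_zero, Real.rpow_zero, one_mul, one_mul,
    mul_mul_mul_comm, ← Real.exp_add]
  gcongr
  have : 0 < x * (p.1 * p.2) := by positivity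
  nlinarith

/-- Both sides, multiplied by `Γ(a+1)Γ(b+1)`, equal up to the same power of `x` the double integral
of `τᵃ sᵇ e^{-x(τ+s+τs)}`, taken in the two orders of integration. -/
lemma cpow_mul_kummerReg_symm_of_neg_one_lt {a b : ℂ} (ha : -1 < a.re) (hb : -1 < b.re) {x : ℝ}
    (hx : 0 < x) :
    (x : ℂ) ^ a * kummerReg a (-b - 1) x = (x : ℂ) ^ b * kummerReg b (-a - 1) x := by
  have hA : Complex.Gamma (a + 1) ≠ 0 := Complex.Gamma_ne_zero_of_re_pos (by simp; linarith)
  have hB : Complex.Gamma (b + 1) ≠ 0 := Complex.Gamma_ne_zero_of_re_pos (by simp; linarith)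
  have hx' : (x : ℂ) ≠ 0 := by exact_mod_cast hx.ne'
  have h1 := kummerInt_mul_Gamma (a := a) hb hx
  have h2 := kummerInt_mul_Gamma (a := b) ha hx
  have h3 := integral_integral_swap (f := fun τ s : ℝ => (τ : ℂ) ^ a * (s : ℂ) ^ b *
    Complex.exp (-(x * (τ + s + τ * s)))) (integrable_kummer_double ha hb hx)
  rw [h3] at h1
  have h4 : (∫ s in Ioi (0 : ℝ), ∫ τ in Ioi (0 : ℝ),
        (τ : ℂ) ^ a * (s : ℂ) ^ b * Complex.exp (-(x * (τ + s + τ * s))))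
      = ∫ τ in Ioi (0 : ℝ), ∫ s in Ioi (0 : ℝ),
        (τ : ℂ) ^ b * (s : ℂ) ^ a * Complex.exp (-(x * (τ + s + τ * s))) := by
    congr 1; ext s; congr 1; ext τ
    ring_nf
  rw [h4] at h1
  rw [Complex.cpow_add _ _ hx', Complex.cpow_one] at h1 h2
  rw [kummerReg_of_neg_one_lt ha, kummerReg_of_neg_one_lt hb]
  field_simp
  linear_combination (x : ℂ) ^ a * h1 - (x : ℂ) ^ b * h2

lemma eq_of_differentiable_of_eq_on_halfPlane {f g : ℂ → ℂ} (hf : Differentiable ℂ f)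
    (hg : Differentiable ℂ g) (h : ∀ s : ℂ, -1 < s.re → f s = g s) : f = g := by
  refine AnalyticOnNhd.eq_of_eventuallyEq (𝕜 := ℂ) (z₀ := 0)
    (Complex.analyticOnNhd_univ_iff_differentiable.2 hf)
    (Complex.analyticOnNhd_univ_iff_differentiable.2 hg) ?_
  have : ∀ᶠ s : ℂ in 𝓝 0, -1 < s.re :=
    Complex.continuous_re.continuousAt.eventually_const_lt (by simp)
  filter_upwards [this] with s hs using h s hs

/-- The Kummer transformation. -/
lemma cpow_mul_kummerReg_symm (a b : ℂ) {x : ℝ} (hx : 0 < x) :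
    (x : ℂ) ^ a * kummerReg a (-b - 1) x = (x : ℂ) ^ b * kummerReg b (-a - 1) x := by
  have hx' : (x : ℂ) ≠ 0 := by exact_mod_cast hx.ne'
  have d1 : ∀ b : ℂ, Differentiable ℂ fun a => (x : ℂ) ^ a * kummerReg a (-b - 1) x := fun b =>
    (differentiable_id.const_cpow (Or.inl hx')).mul
      ((differentiable_kummerReg hx).comp (f := fun a => (a, -b - 1)) (by fun_prop))
  have d2 : ∀ a : ℂ, Differentiable ℂ fun b => (x : ℂ) ^ a * kummerReg a (-b - 1) x := fun a =>
    ((differentiable_kummerReg hx).comp (f := fun b => (a, -b - 1)) (by fun_prop)).const_mul _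
  -- The identity theorem is applied one variable at a time: first in `a` with `Re b > -1`, then in
  -- `b` with `a` arbitrary.
  have h1 : ∀ b : ℂ, -1 < b.re → ∀ a : ℂ,
      (x : ℂ) ^ a * kummerReg a (-b - 1) x = (x : ℂ) ^ b * kummerReg b (-a - 1) x := fun b hb a =>
    congrFun (eq_of_differentiable_of_eq_on_halfPlane (d1 b) (d2 b) fun a ha =>
      cpow_mul_kummerReg_symm_of_neg_one_lt ha hb hx) a
  exact congrFun (eq_of_differentiable_of_eq_on_halfPlane (d2 a) (d1 a) fun b hb => h1 b hb a) b

/-- The Kummer transformation with exponents `±μ - κ - 1/2`, multiplied by the common factor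
`x^{κ+1} e^{-x/2}`. -/
lemma whittakerW_neg (κ μ : ℂ) {x : ℝ} (hx : 0 < x) : whittakerW κ (-μ) x = whittakerW κ μ x := by
  have hx' : (x : ℂ) ≠ 0 := by exact_mod_cast hx.ne'
  have h := cpow_mul_kummerReg_symm (μ - κ - 1 / 2) (-μ - κ - 1 / 2) hx
  rw [show -(-μ - κ - 1 / 2) - 1 = μ + κ - 1 / 2 by ring,
    show -(μ - κ - 1 / 2) - 1 = -μ + κ - 1 / 2 by ring] at h
  rw [whittakerW_eq_kummerReg, whittakerW_eq_kummerReg,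
    show μ + 1 / 2 = (μ - κ - 1 / 2) + (κ + 1) by ring,
    show -μ + 1 / 2 = (-μ - κ - 1 / 2) + (κ + 1) by ring, Complex.cpow_add _ (κ + 1) hx',
    Complex.cpow_add _ (κ + 1) hx']
  linear_combination -Complex.exp (-(x : ℂ) / 2) * (x : ℂ) ^ (κ + 1) * h

lemma whittakerW_units_smul (s : ℤˣ) (κ μ : ℂ) {x : ℝ} (hx : 0 < x) :
    whittakerW κ (((s : ℤ) : ℂ) * μ) x = whittakerW κ μ x := by
  rcases Int.units_eq_one_or s with rfl | rfl
  · simp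
  · simpa using whittakerW_neg κ μ hx

lemma differentiable_whittakerW {x : ℝ} (hx : 0 < x) :
    Differentiable ℂ (fun p : ℂ × ℂ => whittakerW p.1 p.2 x) := by
  have hx' : (x : ℂ) ≠ 0 := by exact_mod_cast hx.ne'
  simp only [whittakerW_eq_kummerReg]
  refine Differentiable.mul (Differentiable.const_mul (Differentiable.const_cpow (by fun_prop)
    (Or.inl hx')) _) ?_
  exact (differentiable_kummerReg hx).comp
    (f := fun p : ℂ × ℂ => (p.2 - p.1 - 1 / 2, p.2 + p.1 - 1 / 2)) (by fun_prop)

lemma differentiable_formulaMM (s : Fin 4 → ℤˣ) {x y : ℝ} (hx : 0 < x) (hy : 0 < y) :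
    Differentiable ℂ (fun p : ℂ × ℂ => formulaMM s p.1 p.2 x y) := by
  have hxy : ((x / y : ℝ) : ℂ) ≠ 0 := by exact_mod_cast (by positivity : x / y ≠ 0)
  have hG : Differentiable ℂ fun u : ℂ => (Complex.Gamma u)⁻¹ :=
    Complex.differentiable_one_div_Gamma
  have hW : ∀ {x : ℝ}, 0 < x → ∀ κ μ : ℂ × ℂ → ℂ, Differentiable ℂ κ → Differentiable ℂ μ →
      Differentiable ℂ fun p => whittakerW (κ p) (μ p) x := fun hx κ μ hκ hμ =>
    (differentiable_whittakerW hx).comp (f := fun p => (κ p, μ p)) (hκ.prodMk hμ)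
  unfold formulaMM
  simp only [one_div, mul_inv]
  refine ((((Differentiable.mul (hG.comp differentiable_fst.neg)
    (hG.comp differentiable_snd.neg)).mul (Differentiable.const_cpow (by fun_prop)
    (Or.inl hxy))).mul_const _).mul_const _).mul ?_
  simp only [div_eq_mul_inv]
  refine Differentiable.mul_const ?_ _
  refine ((hW hx _ _ ?_ ?_).mul (hW hy _ _ ?_ ?_)).sub ((hW hx _ _ ?_ ?_).mul (hW hy _ _ ?_ ?_)) <;>
  fun_prop

/-! ### Multiplicative convolution of gamma and beta weights, and its Stieltjes transform. -/

lemma injOn_inv_one_add : InjOn (fun τ : ℝ => 1 / (1 + τ)) (Ioi 0) := by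
  intro a (ha : 0 < a) b (hb : 0 < b) h
  have : 1 + a = 1 + b := by simpa using h
  linarith

lemma image_inv_one_add : (fun τ : ℝ => 1 / (1 + τ)) '' Ioi 0 = Ioo 0 1 := by
  ext p
  constructor
  · rintro ⟨τ, hτ, rfl⟩
    have : 0 < τ := hτ
    exact ⟨by positivity, by rw [div_lt_one (by positivity)]; linarith⟩
  · rintro ⟨h0, h1⟩
    refine ⟨1 / p - 1, ?_, by simp⟩
    rw [mem_Ioi, sub_pos, lt_div_iff₀ h0]
    linarith

lemma hasDerivAt_inv_one_add {τ : ℝ} (hτ : 0 < τ) :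
    HasDerivAt (fun τ : ℝ => 1 / (1 + τ)) (-(1 / (1 + τ) ^ 2)) τ := by
  have h : HasDerivAt (fun t : ℝ => 1 + t) 1 τ := (hasDerivAt_id τ).const_add 1
  have h2 := h.fun_inv (by positivity : 1 + τ ≠ 0)
  simpa [one_div, neg_div] using h2

lemma integral_Ioo_eq_integral_Ioi_inv_one_add (F : ℝ → ℂ) :
    ∫ p in Ioo (0 : ℝ) 1, F p =
      ∫ τ in Ioi (0 : ℝ), (((1 + τ) ^ 2 : ℝ) : ℂ)⁻¹ * F (1 / (1 + τ)) := by
  rw [← image_inv_one_add, integral_image_eq_integral_abs_deriv_smul measurableSet_Ioi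
    (fun τ hτ => (hasDerivAt_inv_one_add hτ).hasDerivWithinAt) injOn_inv_one_add]
  refine setIntegral_congr_fun measurableSet_Ioi fun τ (hτ : 0 < τ) => ?_
  rw [abs_neg, abs_of_pos (by positivity), Complex.real_smul, one_div, Complex.ofReal_inv]

lemma integrableOn_Ioo_iff_integrableOn_Ioi_inv_one_add (F : ℝ → ℂ) :
    IntegrableOn F (Ioo 0 1) ↔
      IntegrableOn (fun τ : ℝ => (((1 + τ) ^ 2 : ℝ) : ℂ)⁻¹ * F (1 / (1 + τ))) (Ioi 0) := by
  rw [← image_inv_one_add, integrableOn_image_iff_integrableOn_abs_deriv_smul measurableSet_Ioi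
    (fun τ hτ => (hasDerivAt_inv_one_add hτ).hasDerivWithinAt) injOn_inv_one_add]
  refine integrableOn_congr_fun (fun τ (hτ : 0 < τ) => ?_) measurableSet_Ioi
  rw [abs_neg, abs_of_pos (by positivity), Complex.real_smul, one_div, Complex.ofReal_inv]

/-- The beta weight `pᶜ (1-p)ᵈ`. -/
def betaWeight (c d : ℂ) (p : ℝ) : ℂ := (p : ℂ) ^ c * ((1 - p : ℝ) : ℂ) ^ d

/-- The gamma weight `uᵐ e^{-u}`. -/
def gammaWeight (m : ℂ) (u : ℝ) : ℂ := (u : ℂ) ^ m * Complex.exp (-(u : ℂ))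

@[fun_prop]
lemma measurable_betaWeight (c d : ℂ) : Measurable (betaWeight c d) := by
  unfold betaWeight; fun_prop

@[fun_prop]
lemma measurable_gammaWeight (m : ℂ) : Measurable (gammaWeight m) := by
  unfold gammaWeight; fun_prop

lemma integrableOn_betaWeight {c d : ℂ} (hc : -1 < c.re) (hd : -1 < d.re) :
    IntegrableOn (betaWeight c d) (Ioo 0 1) := by
  have h := Complex.betaIntegral_convergent (u := c + 1) (v := d + 1) (by simp; linarith)
    (by simp; linarith)
  rw [intervalIntegrable_iff_integrableOn_Ioo_of_le zero_le_one] at h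
  refine h.congr_fun (fun p _ => ?_) measurableSet_Ioo
  simp [betaWeight]

lemma integral_betaWeight {c d : ℂ} (hc : -1 < c.re) (hd : -1 < d.re) :
    ∫ p in Ioo (0 : ℝ) 1, betaWeight c d p * Complex.Gamma (c + d + 2) =
      Complex.Gamma (c + 1) * Complex.Gamma (d + 1) := by
  rw [Complex.Gamma_mul_Gamma_eq_betaIntegral (by simp; linarith) (by simp; linarith),
    integral_mul_const, mul_comm, show c + 1 + (d + 1) = c + d + 2 by ring, Complex.betaIntegral,
    intervalIntegral.integral_of_le zero_le_one, integral_Ioc_eq_integral_Ioo]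
  congr 1
  refine setIntegral_congr_fun measurableSet_Ioo fun p _ => ?_
  simp [betaWeight]

lemma integrableOn_gammaWeight {m : ℂ} (hm : -1 < m.re) : IntegrableOn (gammaWeight m) (Ioi 0) := by
  refine (integrableOn_kummerIntegrand hm 0 one_pos).congr_fun (fun u _ => ?_) measurableSet_Ioi
  simp [kummerIntegrand, gammaWeight]

lemma betaWeight_inv_one_add (c d : ℂ) {τ : ℝ} (hτ : 0 < τ) :
    (((1 + τ) ^ 2 : ℝ) : ℂ)⁻¹ * betaWeight c d (1 / (1 + τ)) =
      (τ : ℂ) ^ d * ((1 + τ : ℝ) : ℂ) ^ (-c - d - 2) := by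
  have h1 : 0 < 1 + τ := by positivity
  have h0 : ((1 + τ : ℝ) : ℂ) ≠ 0 := by exact_mod_cast h1.ne'
  have harg : ((1 + τ : ℝ) : ℂ).arg ≠ Real.pi :=
    Complex.arg_ofReal_of_nonneg h1.le ▸ Real.pi_pos.ne
  have h2 : 1 - 1 / (1 + τ) = τ * (1 + τ)⁻¹ := by field_simp; ring
  rw [betaWeight, h2, Complex.ofReal_mul, Complex.mul_cpow_ofReal_nonneg hτ.le (by positivity),
    one_div, Complex.ofReal_inv, Complex.inv_cpow _ _ harg, Complex.inv_cpow _ _ harg,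
    ← Complex.cpow_neg, ← Complex.cpow_neg, sub_eq_add_neg, sub_eq_add_neg, Complex.cpow_add _ _ h0,
    Complex.cpow_add _ _ h0, Complex.cpow_neg _ 2]
  push_cast
  rw [Complex.cpow_ofNat]
  ring

lemma integrableOn_cpow_one_add_cpow {c d : ℂ} (hc : -1 < c.re) (hd : -1 < d.re) :
    IntegrableOn (fun τ : ℝ => (τ : ℂ) ^ d * ((1 + τ : ℝ) : ℂ) ^ (-c - d - 2)) (Ioi 0) := by
  refine ((integrableOn_Ioo_iff_integrableOn_Ioi_inv_one_add _).1
    (integrableOn_betaWeight hc hd)).congr_fun (fun τ hτ => ?_) measurableSet_Ioi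
  exact betaWeight_inv_one_add c d hτ

lemma integral_betaWeight_mul (c d : ℂ) (Φ : ℝ → ℂ) :
    ∫ p in Ioo (0 : ℝ) 1, betaWeight c d p * Φ p =
      ∫ τ in Ioi (0 : ℝ), (τ : ℂ) ^ d * ((1 + τ : ℝ) : ℂ) ^ (-c - d - 2) * Φ (1 / (1 + τ)) := by
  rw [integral_Ioo_eq_integral_Ioi_inv_one_add]
  refine setIntegral_congr_fun measurableSet_Ioi fun τ hτ => ?_
  rw [← mul_assoc, betaWeight_inv_one_add c d hτ]

/-- `∫ xᵐ e^{-sx} h(x) dx = s^{-m-1} ∫ uᵐ e^{-u} h(u/s) du`. -/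
lemma integral_gammaWeight_scale (m : ℂ) {s : ℝ} (hs : 0 < s) (h : ℝ → ℂ) :
    ∫ x in Ioi (0 : ℝ), (x : ℂ) ^ m * Complex.exp (-((s * x : ℝ) : ℂ)) * h x =
      (s : ℂ) ^ (-m - 1) * ∫ u in Ioi (0 : ℝ), gammaWeight m u * h (u * (1 / s)) := by
  have hs' : (s : ℂ) ≠ 0 := by exact_mod_cast hs.ne'
  have e := integral_comp_mul_left_Ioi (fun u => gammaWeight m u * h (u * (1 / s))) 0 hs
  rw [mul_zero, Complex.real_smul] at e
  have e2 : ∫ u in Ioi (0 : ℝ), gammaWeight m u * h (u * (1 / s)) = (s : ℂ) *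
      ∫ x in Ioi (0 : ℝ), gammaWeight m (s * x) * h (s * x * (1 / s)) := by
    rw [e, Complex.ofReal_inv]
    field_simp
  rw [e2, ← mul_assoc, ← integral_const_mul]
  refine setIntegral_congr_fun measurableSet_Ioi fun x (hx : 0 < x) => ?_
  rw [gammaWeight, Complex.ofReal_mul, Complex.mul_cpow_ofReal_nonneg hs.le hx.le,
    show s * x * (1 / s) = x by field_simp, show -m - 1 = -(m + 1) by ring, Complex.cpow_neg,
    Complex.cpow_add _ _ hs', Complex.cpow_one]
  have : (s : ℂ) ^ m ≠ 0 := by simp [Complex.cpow_eq_zero_iff, hs']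
  field_simp

/-- Integrating in `x` first gives `Γ(Re m + 1)` times `(1+τ)^{-Re m - 1}`, which turns the exponent
of `1+τ` into `-Re c - Re d - 2`. What remains is the beta integral after the substitution `p =
1/(1+τ)`. -/
lemma integrable_gammaWeight_kummerIntegrand {m c d : ℂ} (hm : -1 < m.re) (hc : -1 < c.re)
    (hd : -1 < d.re) :
    Integrable (fun q : ℝ × ℝ => gammaWeight m q.1 * kummerIntegrand d (m - c - d - 1) q.1 q.2)
      ((volume.restrict (Ioi 0)).prod (volume.restrict (Ioi 0))) := by
  have hmeas : Measurable fun q : ℝ × ℝ =>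
      gammaWeight m q.1 * kummerIntegrand d (m - c - d - 1) q.1 q.2 := by
    unfold kummerIntegrand; fun_prop
  have hnorm : ∀ τ : ℝ, 0 < τ → ∀ x : ℝ, 0 < x →
      ‖gammaWeight m x * kummerIntegrand d (m - c - d - 1) x τ‖ =
        τ ^ d.re * (1 + τ) ^ (m - c - d - 1).re *
          (x ^ (m.re + 1 - 1) * Real.exp (-((1 + τ) * x))) := by
    intro τ hτ x hx
    rw [norm_mul, norm_kummerIntegrand _ _ _ hτ, gammaWeight, norm_mul,
      Complex.norm_cpow_eq_rpow_re_of_pos hx, Complex.norm_exp, add_sub_cancel_right,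
      show -((1 + τ) * x) = -x + -τ * x by ring, Real.exp_add]
    simp only [Complex.neg_re, Complex.ofReal_re]
    ring
  rw [integrable_prod_iff' hmeas.aestronglyMeasurable]
  constructor
  · filter_upwards [ae_restrict_mem measurableSet_Ioi] with τ (hτ : 0 < τ)
    have hi := ((integrableOn_rpow_one_add_rpow_exp hm 0 (by linarith : 0 < 1 + τ)).const_mul
      (τ ^ d.re * (1 + τ) ^ (m - c - d - 1).re))
    refine Integrable.mono' hi (hmeas.comp measurable_prodMk_right).aestronglyMeasurable ?_
    filter_upwards [ae_restrict_mem measurableSet_Ioi] with x hx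
    rw [hnorm τ hτ x hx, add_sub_cancel_right, Real.rpow_zero, one_mul, neg_mul, mul_comm x]
  · refine (((integrableOn_cpow_one_add_cpow hc hd).norm).mul_const
      (Real.Gamma (m.re + 1))).congr ?_
    filter_upwards [ae_restrict_mem measurableSet_Ioi] with τ (hτ : 0 < τ)
    have h1 : 0 < 1 + τ := by positivity
    rw [setIntegral_congr_fun measurableSet_Ioi (hnorm τ hτ), integral_const_mul,
      Real.integral_rpow_mul_exp_neg_mul_Ioi (by linarith) h1, norm_mul,
      Complex.norm_cpow_eq_rpow_re_of_pos hτ, Complex.norm_cpow_eq_rpow_re_of_pos h1, one_div,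
      Real.inv_rpow h1.le, ← Real.rpow_neg h1.le, ← mul_assoc,
      mul_assoc (τ ^ d.re) ((1 + τ) ^ (m - c - d - 1).re), ← Real.rpow_add h1]
    congr 3
    simp
    ring

/-- The density `xᵐ e^{-x} ∫ τᵈ (1+τ)^{m-c-d-1} e^{-τx} dτ` of the multiplicative convolution of
`uᵐ e^{-u}` and `pᶜ (1-p)ᵈ`. -/
def convDensity (m c d : ℂ) (x : ℝ) : ℂ := gammaWeight m x * kummerInt d (m - c - d - 1) x

lemma integrableOn_convDensity {m c d : ℂ} (hm : -1 < m.re) (hc : -1 < c.re) (hd : -1 < d.re) :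
    IntegrableOn (convDensity m c d) (Ioi 0) := by
  have h := (integrable_gammaWeight_kummerIntegrand hm hc hd).integral_prod_left
  simp only [integral_const_mul] at h
  exact h

/-- Substitute `p = 1/(1+τ)` and then `u = (1+τ)x`, so that `up = x`: the exponential becomes
`e^{-x}e^{-τx}` and the powers of `1+τ` combine to `m-c-d-1`. Boundedness of `h` justifies Fubini
both before and after the substitution. -/
lemma integral_gammaWeight_betaWeight {m c d : ℂ} (hm : -1 < m.re) (hc : -1 < c.re)
    (hd : -1 < d.re) {h : ℝ → ℂ} (hmeas : Measurable h) {M : ℝ} (hM : ∀ x, 0 < x → ‖h x‖ ≤ M) :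
    ∫ u in Ioi (0 : ℝ), gammaWeight m u * ∫ p in Ioo (0 : ℝ) 1, betaWeight c d p * h (u * p) =
      ∫ x in Ioi (0 : ℝ), convDensity m c d x * h x := by
  have swap1 := integral_integral_swap (μ := volume.restrict (Ioi (0 : ℝ)))
    (ν := volume.restrict (Ioo (0 : ℝ) 1))
    (f := fun u p => gammaWeight m u * betaWeight c d p * h (u * p)) (by
      refine ((integrableOn_gammaWeight hm).mul_prod (integrableOn_betaWeight hc hd)).mul_bdd
        (c := M) (g := fun z : ℝ × ℝ => h (z.1 * z.2))
        (hmeas.comp (measurable_fst.mul measurable_snd)).aestronglyMeasurable ?_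
      rw [Measure.prod_restrict]
      filter_upwards [ae_restrict_mem (measurableSet_Ioi.prod measurableSet_Ioo)] with q hq
      exact hM _ (mul_pos hq.1 hq.2.1))
  have swap2 := integral_integral_swap (μ := volume.restrict (Ioi (0 : ℝ)))
    (ν := volume.restrict (Ioi (0 : ℝ)))
    (f := fun x τ => gammaWeight m x * kummerIntegrand d (m - c - d - 1) x τ * h x) (by
      refine (integrable_gammaWeight_kummerIntegrand hm hc hd).mul_bdd (c := M)
        (g := fun z : ℝ × ℝ => h z.1)
        (hmeas.comp measurable_fst).aestronglyMeasurable ?_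
      rw [Measure.prod_restrict]
      filter_upwards [ae_restrict_mem (measurableSet_Ioi.prod measurableSet_Ioi)] with q hq
      exact hM _ hq.1)
  simp only [mul_assoc, integral_const_mul] at swap1
  rw [swap1]
  have hL : ∫ p in Ioo (0 : ℝ) 1, ∫ u in Ioi (0 : ℝ), gammaWeight m u *
      (betaWeight c d p * h (u * p)) = ∫ p in Ioo (0 : ℝ) 1, betaWeight c d p *
        ∫ u in Ioi (0 : ℝ), gammaWeight m u * h (u * p) := by
    congr 1; ext p
    rw [← integral_const_mul]
    congr 1; ext u
    ring
  have hR : ∫ x in Ioi (0 : ℝ), convDensity m c d x * h x = ∫ x in Ioi (0 : ℝ),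
      ∫ τ in Ioi (0 : ℝ), gammaWeight m x * kummerIntegrand d (m - c - d - 1) x τ * h x := by
    simp only [convDensity, kummerInt, integral_const_mul, integral_mul_const]
  rw [hL, hR, swap2, integral_betaWeight_mul]
  refine setIntegral_congr_fun measurableSet_Ioi fun τ (hτ : 0 < τ) => ?_
  have h1 : 0 < 1 + τ := by positivity
  have h0 : ((1 + τ : ℝ) : ℂ) ≠ 0 := by exact_mod_cast h1.ne'
  have e := integral_gammaWeight_scale m h1 h
  have e2 : ∫ x in Ioi (0 : ℝ), gammaWeight m x * kummerIntegrand d (m - c - d - 1) x τ * h x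
      = (τ : ℂ) ^ d * ((1 + τ : ℝ) : ℂ) ^ (m - c - d - 1) *
        ∫ x in Ioi (0 : ℝ), (x : ℂ) ^ m * Complex.exp (-(((1 + τ) * x : ℝ) : ℂ)) * h x := by
    rw [← integral_const_mul]
    congr 1; ext x
    rw [gammaWeight, kummerIntegrand, show -(((1 + τ) * x : ℝ) : ℂ) = -(x : ℂ) + -(τ : ℂ) * x by
      push_cast; ring, Complex.exp_add]
    ring
  rw [e2, e, show -c - d - 2 = (m - c - d - 1) + (-m - 1) by ring, Complex.cpow_add _ _ h0]
  ring

/-- When the beta exponents sum to `-1`, the substitution `p = 1/(1+τ)` gives `∫ τ^{-c-1}/(1+w+τ)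
dτ`, which is homogeneous in `1+w`. So the dependence on `w` is a pure power. -/
lemma integral_betaWeight_div {c : ℂ} (hc : -1 < c.re) (hc' : c.re < 0) {w : ℝ} (hw : 0 ≤ w) :
    ∫ p in Ioo (0 : ℝ) 1, betaWeight c (-c - 1) p * (1 / ((1 + w * p : ℝ) : ℂ)) =
      ((1 + w : ℝ) : ℂ) ^ (-c - 1) * (Complex.Gamma (c + 1) * Complex.Gamma (-c)) := by
  have key : ∀ w : ℝ, 0 ≤ w →
      ∫ p in Ioo (0 : ℝ) 1, betaWeight c (-c - 1) p * (1 / ((1 + w * p : ℝ) : ℂ)) =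
        ((1 + w : ℝ) : ℂ) ^ (-c - 1) * ∫ τ in Ioi (0 : ℝ), (τ : ℂ) ^ (-c - 1) *
          (1 / ((1 + τ : ℝ) : ℂ)) := by
    intro w hw
    have hw1 : 0 < 1 + w := by linarith
    have hw0 : ((1 + w : ℝ) : ℂ) ≠ 0 := by exact_mod_cast hw1.ne'
    rw [integral_betaWeight_mul]
    have e := integral_comp_mul_left_Ioi (fun u : ℝ => (u : ℂ) ^ (-c - 1) *
      (1 / ((1 + w + u : ℝ) : ℂ))) 0 hw1
    rw [mul_zero, Complex.real_smul] at e
    have e1 : ∫ τ in Ioi (0 : ℝ), (τ : ℂ) ^ (-c - 1) * ((1 + τ : ℝ) : ℂ) ^ (-c - (-c - 1) - 2) *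
        (1 / ((1 + w * (1 / (1 + τ)) : ℝ) : ℂ))
        = ∫ u in Ioi (0 : ℝ), (u : ℂ) ^ (-c - 1) * (1 / ((1 + w + u : ℝ) : ℂ)) := by
      refine setIntegral_congr_fun measurableSet_Ioi fun τ (hτ : 0 < τ) => ?_
      have h1 : ((1 + τ : ℝ) : ℂ) ≠ 0 := by exact_mod_cast (by positivity : (1 + τ : ℝ) ≠ 0)
      have h2 : ((1 + w + τ : ℝ) : ℂ) ≠ 0 := by
        exact_mod_cast (by positivity : (1 + w + τ : ℝ) ≠ 0)
      rw [show -c - (-c - 1) - 2 = -1 by ring, Complex.cpow_neg_one,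
        show 1 + w * (1 / (1 + τ)) = (1 + w + τ) * (1 + τ)⁻¹ by field_simp; ring,
        Complex.ofReal_mul, Complex.ofReal_inv]
      field_simp
    have e2 : ∫ u in Ioi (0 : ℝ), (((1 + w) * u : ℝ) : ℂ) ^ (-c - 1) *
        (1 / ((1 + w + (1 + w) * u : ℝ) : ℂ)) =
        ((1 + w : ℝ) : ℂ)⁻¹ * (((1 + w : ℝ) : ℂ) ^ (-c - 1) *
          ∫ τ in Ioi (0 : ℝ), (τ : ℂ) ^ (-c - 1) * (1 / ((1 + τ : ℝ) : ℂ))) := by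
      rw [← integral_const_mul, ← integral_const_mul]
      refine setIntegral_congr_fun measurableSet_Ioi fun τ (hτ : 0 < τ) => ?_
      rw [Complex.ofReal_mul, Complex.mul_cpow_ofReal_nonneg hw1.le hτ.le,
        show 1 + w + (1 + w) * τ = (1 + w) * (1 + τ) by ring, Complex.ofReal_mul]
      field_simp
    rw [e2, Complex.ofReal_inv] at e
    rw [e1, ← mul_left_cancel₀ (inv_ne_zero hw0) e]
  -- At `w = 0` the integral is a complete beta integral, which evaluates the constant.
  have h0 := key 0 le_rfl
  have hb := integral_betaWeight (c := c) (d := -c - 1) hc (by simp; linarith)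
  rw [show c + (-c - 1) + 2 = 1 by ring, Complex.Gamma_one, sub_add_cancel] at hb
  simp only [mul_one] at hb
  simp only [zero_mul, add_zero, Complex.ofReal_one, Complex.one_cpow, one_mul, div_one, mul_one]
    at h0
  rw [key w hw, ← h0, hb]

/-- The Stieltjes transform of the density of the multiplicative convolution. -/
lemma integral_convDensity_div {z z' : ℂ} (hz : -1 < z.re) (hz0 : z.re < 0) (hz' : -1 < z'.re)
    {x : ℝ} (hx : 0 < x) :
    ∫ r in Ioi (0 : ℝ), convDensity z' z (-z - 1) r * (1 / ((r + x : ℝ) : ℂ)) =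
      Complex.Gamma (z + 1) * Complex.Gamma (-z) * ((x : ℂ) ^ z' * kummerInt z' (-z - 1) x) := by
  have hx0 : (x : ℂ) ≠ 0 := by exact_mod_cast hx.ne'
  have hbd : ∀ r : ℝ, 0 < r → ‖1 / ((r + x : ℝ) : ℂ)‖ ≤ 1 / x := by
    intro r hr
    rw [norm_div, norm_one, Complex.norm_real, Real.norm_of_nonneg (by positivity)]
    exact one_div_le_one_div_of_le hx (by linarith)
  rw [← integral_gammaWeight_betaWeight hz' hz (d := -z - 1) (by simp; linarith)
    (h := fun r => 1 / ((r + x : ℝ) : ℂ)) (by fun_prop) hbd]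
  have e1 : ∀ u ∈ Ioi (0 : ℝ), (gammaWeight z' u * ∫ p in Ioo (0 : ℝ) 1, betaWeight z (-z - 1) p *
      (1 / ((u * p + x : ℝ) : ℂ))) = gammaWeight z' u * ((x : ℂ)⁻¹ *
        (((1 + u / x : ℝ) : ℂ) ^ (-z - 1) * (Complex.Gamma (z + 1) * Complex.Gamma (-z)))) := by
    intro u (hu : 0 < u)
    have hux : 0 ≤ u / x := by positivity
    rw [← integral_betaWeight_div hz hz0 hux, ← integral_const_mul ((x : ℂ)⁻¹)]
    congr 1
    refine setIntegral_congr_fun measurableSet_Ioo fun p hp => ?_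
    have h1 : ((1 + u / x * p : ℝ) : ℂ) ≠ 0 := by
      have := hp.1
      exact_mod_cast (by positivity : (1 + u / x * p : ℝ) ≠ 0)
    rw [show u * p + x = x * (1 + u / x * p) by field_simp; ring, Complex.ofReal_mul]
    field_simp
  rw [setIntegral_congr_fun measurableSet_Ioi e1]
  -- With `u = xτ` the gamma weight becomes `x^{z'} τ^{z'} e^{-xτ}` and `1 + u/x` becomes `1 + τ`,
  -- while the Jacobian cancels `x⁻¹`.
  have e := integral_comp_mul_left_Ioi (fun u : ℝ => gammaWeight z' u * ((x : ℂ)⁻¹ *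
        (((1 + u / x : ℝ) : ℂ) ^ (-z - 1) * (Complex.Gamma (z + 1) * Complex.Gamma (-z))))) 0 hx
  rw [mul_zero, Complex.real_smul, Complex.ofReal_inv] at e
  refine mul_left_cancel₀ (inv_ne_zero hx0) (e.symm.trans ?_)
  rw [kummerInt, ← integral_const_mul, ← integral_const_mul, ← integral_const_mul]
  refine setIntegral_congr_fun measurableSet_Ioi fun τ (hτ : 0 < τ) => ?_
  rw [gammaWeight, kummerIntegrand, Complex.ofReal_mul, Complex.mul_cpow_ofReal_nonneg hx.le hτ.le,
    show x * τ / x = τ by field_simp, show -((x : ℂ) * τ) = -(τ : ℂ) * x by ring]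
  ring

/-! ### The first-order systems, the bilinear identity, and the closed formula. -/

lemma hasDerivAt_kummerReg (a b : ℂ) {x : ℝ} (hx : 0 < x) :
    HasDerivAt (kummerReg a b) (-(a + 1) * kummerReg (a + 1) b x) x := by
  have key : ∀ n : ℕ, ∀ a b : ℂ, -(n : ℝ) - 1 < a.re →
      HasDerivAt (kummerReg a b) (-(a + 1) * kummerReg (a + 1) b x) x := by
    intro n
    induction n with
    | zero =>
      intro a b ha
      have ha1 : -1 < a.re := by simpa using ha
      have ha' : -1 < (a + 1).re := by simp; linarith
      have ha0 : a + 1 ≠ 0 := fun h => by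
        have := congrArg Complex.re h
        simp at this; linarith
      have hG : Complex.Gamma (a + 1) ≠ 0 := Complex.Gamma_ne_zero_of_re_pos (by simp; linarith)
      have hfun : kummerReg a b = fun x => (Complex.Gamma (a + 1))⁻¹ * kummerInt a b x :=
        funext fun x => kummerReg_of_neg_one_lt ha1 b x
      rw [hfun, kummerReg_of_neg_one_lt ha', Complex.Gamma_add_one _ ha0]
      refine ((hasDerivAt_kummerInt ha1 b hx).const_mul _).congr_deriv ?_
      field_simp
    | succ n ih =>
      intro a b ha
      have ha' : -(n : ℝ) - 1 < (a + 1).re := by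
        push_cast at ha
        simp only [Complex.add_re, Complex.one_re]; linarith
      have hfun : kummerReg a b =ᶠ[𝓝 x] fun x =>
          (x : ℂ) * kummerReg (a + 1) b x - b * kummerReg (a + 1) (b - 1) x := by
        filter_upwards [Ioi_mem_nhds hx] with y hy using kummerReg_by_parts a b hy
      refine HasDerivAt.congr_of_eventuallyEq ?_ hfun
      have h1 := (Complex.ofRealCLM.hasDerivAt (x := x)).mul (ih (a + 1) b ha')
      have h2 := (ih (a + 1) (b - 1) ha').const_mul b
      refine (h1.sub h2).congr_deriv ?_
      have h3 := kummerReg_by_parts (a + 1) b hx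
      simp only [Complex.ofRealCLM_apply, Complex.ofReal_one]
      linear_combination (a + 1 + 1) * h3
  obtain ⟨n, hn⟩ := exists_nat_gt (-a.re - 1)
  exact key n a b (by linarith)

lemma kummerReg_add_one {a : ℂ} (ha : -1 < a.re) (b : ℂ) {x : ℝ} (hx : 0 < x) :
    kummerReg a (b + 1) x = kummerReg a b x + (a + 1) * kummerReg (a + 1) b x := by
  have ha' : -1 < (a + 1).re := by simp; linarith
  have ha0 : a + 1 ≠ 0 := fun h => by
    have := congrArg Complex.re h
    simp at this; linarith
  have hG : Complex.Gamma (a + 1) ≠ 0 := Complex.Gamma_ne_zero_of_re_pos (by simp; linarith)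
  rw [kummerReg_of_neg_one_lt ha, kummerReg_of_neg_one_lt ha, kummerReg_of_neg_one_lt ha',
    kummerInt_add_one ha b hx, Complex.Gamma_add_one _ ha0]
  field_simp

section System

variable {z z' : ℂ}

/-- Eliminating `kummerReg (z + 1) (-z' - 1)` and `kummerReg z (-z')` between the derivative formula
and two contiguous relations closes the pair `kummerReg z (-z' - 1)`, `kummerReg (z - 1) (-z')`
under differentiation. -/
lemma hasDerivAt_kummerReg_left (hz : -1 < z.re) (z' : ℂ) {x : ℝ} (hx : 0 < x) :
    HasDerivAt (kummerReg z (-z' - 1))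
      (((x + z') * kummerReg z (-z' - 1) x - kummerReg (z - 1) (-z') x) / x) x := by
  have hx' : (x : ℂ) ≠ 0 := by exact_mod_cast hx.ne'
  refine (hasDerivAt_kummerReg z (-z' - 1) hx).congr_deriv ?_
  have h1 := kummerReg_by_parts (z - 1) (-z') hx
  have h2 := kummerReg_add_one hz (-z' - 1) hx
  rw [sub_add_cancel] at h1 h2
  rw [eq_div_iff hx']
  linear_combination (x : ℂ) * h2 + h1

lemma hasDerivAt_kummerReg_right (z z' : ℂ) {x : ℝ} (hx : 0 < x) :
    HasDerivAt (kummerReg (z - 1) (-z'))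
      ((z * z' * kummerReg z (-z' - 1) x - z * kummerReg (z - 1) (-z') x) / x) x := by
  have hx' : (x : ℂ) ≠ 0 := by exact_mod_cast hx.ne'
  refine (hasDerivAt_kummerReg (z - 1) (-z') hx).congr_deriv ?_
  have h1 := kummerReg_by_parts (z - 1) (-z') hx
  rw [sub_add_cancel] at h1 ⊢
  rw [eq_div_iff hx']
  linear_combination z * h1

/-- `xᶻ Ψ(z+1, z-z'+1; x)`. -/
def solPhi (z z' : ℂ) (x : ℝ) : ℂ := (x : ℂ) ^ z * kummerReg z (-z' - 1) x

/-- `xᶻ Ψ(z, z-z'+1; x)`. -/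
def solE (z z' : ℂ) (x : ℝ) : ℂ := (x : ℂ) ^ z * kummerReg (z - 1) (-z') x

/-- `y^{-z'} e^{-y} Ψ(z+1, z-z'+1; y)`. -/
def solF (z z' : ℂ) (y : ℝ) : ℂ := gammaWeight (-z') y * kummerReg z (-z' - 1) y

/-- `y^{-z'} e^{-y} Ψ(z, z-z'+1; y)`. -/
def solPsi (z z' : ℂ) (y : ℝ) : ℂ := gammaWeight (-z') y * kummerReg (z - 1) (-z') y

lemma hasDerivAt_cpow_div (r : ℂ) {x : ℝ} (hx : 0 < x) :
    HasDerivAt (fun y : ℝ => (y : ℂ) ^ r) (r * (x : ℂ) ^ r / x) x := by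
  have hx' : (x : ℂ) ≠ 0 := by exact_mod_cast hx.ne'
  refine (hasDerivAt_ofReal_cpow_of_pos r hx).congr_deriv ?_
  rw [Complex.cpow_sub _ _ hx', Complex.cpow_one]
  ring

lemma hasDerivAt_gammaWeight (m : ℂ) {x : ℝ} (hx : 0 < x) :
    HasDerivAt (gammaWeight m) ((m - x) * gammaWeight m x / x) x := by
  have hx' : (x : ℂ) ≠ 0 := by exact_mod_cast hx.ne'
  have h2 : HasDerivAt (fun y : ℝ => -(y : ℂ)) (-1) x := by
    simpa using (Complex.ofRealCLM.hasDerivAt (x := x)).fun_neg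
  refine ((hasDerivAt_cpow_div m hx).mul h2.cexp).congr_deriv ?_
  unfold gammaWeight
  field_simp
  ring

lemma hasDerivAt_solPhi (hz : -1 < z.re) (z' : ℂ) {x : ℝ} (hx : 0 < x) :
    HasDerivAt (solPhi z z') (((z + z' + x) * solPhi z z' x - solE z z' x) / x) x := by
  have hx' : (x : ℂ) ≠ 0 := by exact_mod_cast hx.ne'
  refine ((hasDerivAt_cpow_div z hx).mul (hasDerivAt_kummerReg_left hz z' hx)).congr_deriv ?_
  unfold solPhi solE
  field_simp
  ring

lemma hasDerivAt_solE (z z' : ℂ) {x : ℝ} (hx : 0 < x) :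
    HasDerivAt (solE z z') (z * z' * solPhi z z' x / x) x := by
  have hx' : (x : ℂ) ≠ 0 := by exact_mod_cast hx.ne'
  refine ((hasDerivAt_cpow_div z hx).mul (hasDerivAt_kummerReg_right z z' hx)).congr_deriv ?_
  unfold solPhi
  field_simp
  ring

lemma hasDerivAt_solF (hz : -1 < z.re) (z' : ℂ) {x : ℝ} (hx : 0 < x) :
    HasDerivAt (solF z z') (-solPsi z z' x / x) x := by
  have hx' : (x : ℂ) ≠ 0 := by exact_mod_cast hx.ne'
  refine ((hasDerivAt_gammaWeight (-z') hx).mul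
    (hasDerivAt_kummerReg_left hz z' hx)).congr_deriv ?_
  unfold solPsi
  field_simp
  ring

lemma hasDerivAt_solPsi (z z' : ℂ) {x : ℝ} (hx : 0 < x) :
    HasDerivAt (solPsi z z') ((z * z' * solF z z' x - (z + z' + x) * solPsi z z' x) / x) x := by
  have hx' : (x : ℂ) ≠ 0 := by exact_mod_cast hx.ne'
  refine ((hasDerivAt_gammaWeight (-z') hx).mul
    (hasDerivAt_kummerReg_right z z' hx)).congr_deriv ?_
  unfold solPsi solF
  field_simp
  ring

/-- In `T d/dT` the terms `zz'ΦF`, `EΨ` and `(z+z')ΦΨ` cancel pairwise. Only the coefficients linear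
in the variable survive, and they contribute `-(xT - yT)ΦΨ`. -/
lemma hasDerivAt_bilinear (hz : -1 < z.re) {x y : ℝ} (hx : 0 < x) (hy : 0 < y) {T : ℝ}
    (hT : 0 < T) :
    HasDerivAt (fun T => solE z z' (x * T) * solF z z' (y * T)
        - solPhi z z' (x * T) * solPsi z z' (y * T))
      (-((x : ℂ) - y) * (solPhi z z' (x * T) * solPsi z z' (y * T))) T := by
  have hsc : ∀ {f : ℝ → ℂ} {f' : ℂ} {x : ℝ}, HasDerivAt f f' (x * T) →
      HasDerivAt (fun T => f (x * T)) (x * f') T := by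
    intro f f' x h
    have h1 : HasDerivAt (fun T => x * T) x T := by simpa using (hasDerivAt_id T).const_mul x
    simpa [Function.comp_def] using h.scomp T h1
  have hxT := mul_pos hx hT
  have hyT := mul_pos hy hT
  refine (((hsc (hasDerivAt_solE z z' hxT)).mul (hsc (hasDerivAt_solF hz z' hyT))).sub
    ((hsc (hasDerivAt_solPhi hz z' hxT)).mul (hsc (hasDerivAt_solPsi z z' hyT)))).congr_deriv ?_
  have h1 : (x : ℂ) ≠ 0 := by exact_mod_cast hx.ne'
  have h2 : (y : ℂ) ≠ 0 := by exact_mod_cast hy.ne'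
  have h3 : (T : ℂ) ≠ 0 := by exact_mod_cast hT.ne'
  push_cast
  field_simp
  ring

lemma exists_rpow_le_exp (s : ℝ) {ε δ : ℝ} (hε : 0 < ε) (hδ : 0 < δ) :
    ∃ C : ℝ, 0 ≤ C ∧ ∀ x : ℝ, ε ≤ x → x ^ s ≤ C * Real.exp (δ * x) := by
  rcases le_total 0 s with hs | hs
  · obtain ⟨C, hC0, hC⟩ := exists_one_add_rpow_le_exp s hδ
    exact ⟨C, hC0, fun x hx => (Real.rpow_le_rpow (by linarith) (by linarith) hs).trans
      (hC x (by linarith))⟩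
  · refine ⟨ε ^ s, by positivity, fun x hx => ?_⟩
    have h1 : x ^ s ≤ ε ^ s := Real.rpow_le_rpow_of_nonpos hε hx hs
    have h2 : 1 ≤ Real.exp (δ * x) := Real.one_le_exp (by nlinarith)
    exact h1.trans (le_mul_of_one_le_right (by positivity) h2)

lemma exists_norm_kummerReg_le (hz : -1 < z.re) (b : ℂ) {ε : ℝ} (hε : 0 < ε) :
    ∃ C : ℝ, 0 ≤ C ∧ ∀ x : ℝ, ε ≤ x → ‖kummerReg z b x‖ ≤ C := by
  obtain ⟨C, hC0, hC⟩ := exists_norm_kummerInt_le hz b hε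
  refine ⟨‖(Complex.Gamma (z + 1))⁻¹‖ * C, by positivity, fun x hx => ?_⟩
  rw [kummerReg_of_neg_one_lt hz, norm_mul]
  gcongr
  exact hC x hx

lemma exists_norm_kummerReg_sub_one_le (hz : -1 < z.re) (b : ℂ) {ε δ : ℝ} (hε : 0 < ε)
    (hδ : 0 < δ) : ∃ C : ℝ, 0 ≤ C ∧ ∀ x : ℝ, ε ≤ x →
      ‖kummerReg (z - 1) b x‖ ≤ C * Real.exp (δ * x) := by
  obtain ⟨C₁, h₁, hC₁⟩ := exists_norm_kummerReg_le hz b hε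
  obtain ⟨C₂, h₂, hC₂⟩ := exists_norm_kummerReg_le hz (b - 1) hε
  obtain ⟨C₃, h₃, hC₃⟩ := exists_rpow_le_exp 1 hε hδ
  refine ⟨C₃ * C₁ + ‖b‖ * C₂, by positivity, fun x hx => ?_⟩
  have hx0 : 0 < x := hε.trans_le hx
  have e1 : 1 ≤ Real.exp (δ * x) := Real.one_le_exp (by positivity)
  have e3 := hC₃ x hx
  rw [Real.rpow_one] at e3
  rw [kummerReg_by_parts (z - 1) b hx0, sub_add_cancel]
  refine (norm_sub_le _ _).trans ?_
  rw [norm_mul, norm_mul, Complex.norm_real, Real.norm_of_nonneg hx0.le]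
  calc x * ‖kummerReg z b x‖ + ‖b‖ * ‖kummerReg z (b - 1) x‖
      ≤ (C₃ * Real.exp (δ * x)) * C₁ + ‖b‖ * C₂ * Real.exp (δ * x) := by
        have e4 := hC₁ x hx
        have e5 : ‖kummerReg z (b - 1) x‖ ≤ C₂ * Real.exp (δ * x) :=
          (hC₂ x hx).trans (le_mul_of_one_le_right h₂ e1)
        rw [mul_assoc ‖b‖]
        gcongr
    _ = _ := by ring

lemma exists_norm_cpow_mul_le (m : ℂ) {f : ℝ → ℂ} {ε : ℝ} (hε : 0 < ε)
    (hf : ∀ δ : ℝ, 0 < δ → ∃ C : ℝ, 0 ≤ C ∧ ∀ x : ℝ, ε ≤ x → ‖f x‖ ≤ C * Real.exp (δ * x)) {δ : ℝ}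
    (hδ : 0 < δ) : ∃ C : ℝ, 0 ≤ C ∧ ∀ x : ℝ, ε ≤ x →
      ‖(x : ℂ) ^ m * f x‖ ≤ C * Real.exp (δ * x) := by
  obtain ⟨C₁, h₁, hC₁⟩ := hf (δ / 2) (half_pos hδ)
  obtain ⟨C₂, h₂, hC₂⟩ := exists_rpow_le_exp m.re hε (half_pos hδ)
  refine ⟨C₂ * C₁, by positivity, fun x hx => ?_⟩
  rw [norm_mul, Complex.norm_cpow_eq_rpow_re_of_pos (hε.trans_le hx)]
  calc _ ≤ (C₂ * Real.exp (δ / 2 * x)) * (C₁ * Real.exp (δ / 2 * x)) := by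
        have := hC₁ x hx
        have := hC₂ x hx
        gcongr
    _ = C₂ * C₁ * (Real.exp (δ / 2 * x) * Real.exp (δ / 2 * x)) := by ring
    _ = _ := by rw [← Real.exp_add]; ring_nf

lemma exists_norm_gammaWeight_mul_le (m : ℂ) {f : ℝ → ℂ} {ε : ℝ} (hε : 0 < ε)
    (hf : ∀ δ : ℝ, 0 < δ → ∃ C : ℝ, 0 ≤ C ∧ ∀ x : ℝ, ε ≤ x → ‖f x‖ ≤ C * Real.exp (δ * x)) :
    ∃ C : ℝ, 0 ≤ C ∧ ∀ x : ℝ, ε ≤ x → ‖gammaWeight m x * f x‖ ≤ C * Real.exp (-(x / 2)) := by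
  obtain ⟨C, hC0, hC⟩ := exists_norm_cpow_mul_le m hε hf one_half_pos
  refine ⟨C, hC0, fun x hx => ?_⟩
  have h1 : ‖gammaWeight m x * f x‖ = ‖(x : ℂ) ^ m * f x‖ * Real.exp (-x) := by
    rw [gammaWeight, norm_mul, norm_mul, norm_mul, Complex.norm_exp]
    simp only [Complex.neg_re, Complex.ofReal_re]
    ring
  rw [h1]
  refine (mul_le_mul_of_nonneg_right (hC x hx) (Real.exp_nonneg _)).trans (le_of_eq ?_)
  rw [mul_assoc, ← Real.exp_add]
  ring_nf

lemma exists_le_mul_exp_of_le_const {f : ℝ → ℂ} {ε : ℝ} (hε : 0 < ε)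
    (hf : ∃ C : ℝ, 0 ≤ C ∧ ∀ x : ℝ, ε ≤ x → ‖f x‖ ≤ C) (δ : ℝ) (hδ : 0 < δ) :
    ∃ C : ℝ, 0 ≤ C ∧ ∀ x : ℝ, ε ≤ x → ‖f x‖ ≤ C * Real.exp (δ * x) := by
  obtain ⟨C, hC0, hC⟩ := hf
  exact ⟨C, hC0, fun x hx => (hC x hx).trans (le_mul_of_one_le_right hC0
    (Real.one_le_exp (mul_nonneg hδ.le (hε.le.trans hx))))⟩

lemma exists_norm_solPhi_le (hz : -1 < z.re) (z' : ℂ) {ε δ : ℝ} (hε : 0 < ε) (hδ : 0 < δ) :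
    ∃ C : ℝ, 0 ≤ C ∧ ∀ x : ℝ, ε ≤ x → ‖solPhi z z' x‖ ≤ C * Real.exp (δ * x) :=
  exists_norm_cpow_mul_le z hε
    (exists_le_mul_exp_of_le_const hε (exists_norm_kummerReg_le hz (-z' - 1) hε)) hδ

lemma exists_norm_solE_le (hz : -1 < z.re) (z' : ℂ) {ε δ : ℝ} (hε : 0 < ε) (hδ : 0 < δ) :
    ∃ C : ℝ, 0 ≤ C ∧ ∀ x : ℝ, ε ≤ x → ‖solE z z' x‖ ≤ C * Real.exp (δ * x) :=
  exists_norm_cpow_mul_le z hε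
    (fun _ hδ => exists_norm_kummerReg_sub_one_le hz (-z') hε hδ) hδ

lemma exists_norm_solF_le (hz : -1 < z.re) (z' : ℂ) {ε : ℝ} (hε : 0 < ε) :
    ∃ C : ℝ, 0 ≤ C ∧ ∀ x : ℝ, ε ≤ x → ‖solF z z' x‖ ≤ C * Real.exp (-(x / 2)) :=
  exists_norm_gammaWeight_mul_le (-z') hε
    (exists_le_mul_exp_of_le_const hε (exists_norm_kummerReg_le hz (-z' - 1) hε))

lemma exists_norm_solPsi_le (hz : -1 < z.re) (z' : ℂ) {ε : ℝ} (hε : 0 < ε) :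
    ∃ C : ℝ, 0 ≤ C ∧ ∀ x : ℝ, ε ≤ x → ‖solPsi z z' x‖ ≤ C * Real.exp (-(x / 2)) :=
  exists_norm_gammaWeight_mul_le (-z') hε
    (fun _ hδ => exists_norm_kummerReg_sub_one_le hz (-z') hε hδ)

/-- The growth of `f` is subexponential, so it may be charged at rate `ε/(4x)`: `f(xT)` costs
`e^{εT/4}` against the gain `e^{-εT/2}` from `g(yT)`. The constant is uniform in `y ≥ ε`, as
dominated convergence in `y` requires. -/
lemma exists_norm_mul_le_of_exp_le {f g : ℝ → ℂ} {x ε : ℝ} (hx : 0 < x) (hεx : ε ≤ x) (hε : 0 < ε)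
    (hf : ∀ δ : ℝ, 0 < δ → ∃ C : ℝ, 0 ≤ C ∧ ∀ x : ℝ, ε ≤ x → ‖f x‖ ≤ C * Real.exp (δ * x))
    (hg : ∃ C : ℝ, 0 ≤ C ∧ ∀ x : ℝ, ε ≤ x → ‖g x‖ ≤ C * Real.exp (-(x / 2))) :
    ∃ C : ℝ, 0 ≤ C ∧ ∀ y : ℝ, ε ≤ y → ∀ T : ℝ, 1 ≤ T →
      ‖f (x * T) * g (y * T)‖ ≤ C * Real.exp (-(ε / 4) * T) := by
  obtain ⟨C₁, h₁, hC₁⟩ := hf (ε / (4 * x)) (by positivity)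
  obtain ⟨C₂, h₂, hC₂⟩ := hg
  refine ⟨C₁ * C₂, by positivity, fun y hy T hT => ?_⟩
  have e1 := hC₁ (x * T) (by nlinarith)
  have e2 := hC₂ (y * T) (by nlinarith)
  have e3 : Real.exp (-(y * T / 2)) ≤ Real.exp (-(ε * T / 2)) :=
    Real.exp_le_exp.2 (by nlinarith)
  rw [norm_mul]
  calc _ ≤ (C₁ * Real.exp (ε / (4 * x) * (x * T))) * (C₂ * Real.exp (-(ε * T / 2))) := by
        gcongr
        exact e2.trans (by gcongr)
    _ = C₁ * C₂ * (Real.exp (ε / (4 * x) * (x * T)) * Real.exp (-(ε * T / 2))) := by ring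
    _ = _ := by
      rw [← Real.exp_add]
      congr 2
      field_simp
      ring

lemma continuousOn_solPhi (hz : -1 < z.re) (z' : ℂ) : ContinuousOn (solPhi z z') (Ioi 0) :=
  fun _ hx => (hasDerivAt_solPhi hz z' hx).continuousAt.continuousWithinAt

lemma continuousOn_solPsi (z z' : ℂ) : ContinuousOn (solPsi z z') (Ioi 0) :=
  fun _ hx => (hasDerivAt_solPsi z z' hx).continuousAt.continuousWithinAt

lemma aestronglyMeasurable_comp_mul {f : ℝ → ℂ} (hf : ContinuousOn f (Ioi 0)) {x : ℝ}
    (hx : 0 < x) : AEStronglyMeasurable (fun T => f (x * T)) (volume.restrict (Ioi 1)) := by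
  refine ContinuousOn.aestronglyMeasurable ?_ measurableSet_Ioi
  exact hf.comp (by fun_prop) fun T (hT : 1 < T) => mul_pos hx (by linarith)

lemma integrableOn_exp_neg_mul_Ioi_one {c : ℝ} (hc : 0 < c) (C : ℝ) :
    IntegrableOn (fun T : ℝ => C * Real.exp (-c * T)) (Ioi 1) :=
  (integrableOn_exp_mul_Ioi (neg_lt_zero.2 hc) 1).const_mul C

lemma integrableOn_solPhi_solPsi (hz : -1 < z.re) (z' : ℂ) {x y : ℝ} (hx : 0 < x) (hy : 0 < y) :
    IntegrableOn (fun T => solPhi z z' (x * T) * solPsi z z' (y * T)) (Ioi 1) := by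
  have hε : 0 < min x y := lt_min hx hy
  obtain ⟨C, -, hC⟩ := exists_norm_mul_le_of_exp_le hx (min_le_left x y) hε
    (fun _ hδ => exists_norm_solPhi_le hz z' hε hδ) (exists_norm_solPsi_le hz z' hε)
  refine Integrable.mono' (integrableOn_exp_neg_mul_Ioi_one (by positivity : 0 < min x y / 4) C)
    ((aestronglyMeasurable_comp_mul (continuousOn_solPhi hz z') hx).mul
      (aestronglyMeasurable_comp_mul (continuousOn_solPsi z z') hy)) ?_
  filter_upwards [ae_restrict_mem measurableSet_Ioi] with T (hT : 1 < T)
  exact hC y (min_le_right x y) T hT.le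

lemma integral_solPhi_solPsi (hz : -1 < z.re) (z' : ℂ) {x y : ℝ} (hx : 0 < x) (hy : 0 < y)
    (hxy : x ≠ y) :
    ∫ T in Ioi (1 : ℝ), solPhi z z' (x * T) * solPsi z z' (y * T) =
      (solE z z' x * solF z z' y - solPhi z z' x * solPsi z z' y) / ((x : ℂ) - y) := by
  have hε : 0 < min x y := lt_min hx hy
  have hxy' : (x : ℂ) - y ≠ 0 := sub_ne_zero.2 (by exact_mod_cast hxy)
  have htop : Tendsto (fun T => solE z z' (x * T) * solF z z' (y * T)
      - solPhi z z' (x * T) * solPsi z z' (y * T)) atTop (𝓝 0) := by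
    have hlim : ∀ f g : ℝ → ℂ, (∃ C : ℝ, 0 ≤ C ∧ ∀ y' : ℝ, min x y ≤ y' → ∀ T : ℝ, 1 ≤ T →
        ‖f (x * T) * g (y' * T)‖ ≤ C * Real.exp (-(min x y / 4) * T)) →
        Tendsto (fun T => f (x * T) * g (y * T)) atTop (𝓝 0) := by
      rintro f g ⟨C, -, hC⟩
      have h0 : Tendsto (fun T : ℝ => C * Real.exp (-(min x y / 4) * T)) atTop (𝓝 0) := by
        have : Tendsto (fun T : ℝ => -(min x y / 4) * T) atTop atBot :=
          tendsto_id.const_mul_atTop_of_neg (by linarith)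
        simpa using (Real.tendsto_exp_atBot.comp this).const_mul C
      refine squeeze_zero_norm' ?_ h0
      filter_upwards [eventually_ge_atTop 1] with T hT
      exact hC y (min_le_right x y) T hT
    have l1 := hlim _ _ (exists_norm_mul_le_of_exp_le hx (min_le_left x y) hε
      (fun _ hδ => exists_norm_solE_le hz z' hε hδ) (exists_norm_solF_le hz z' hε))
    have l2 := hlim _ _ (exists_norm_mul_le_of_exp_le hx (min_le_left x y) hε
      (fun _ hδ => exists_norm_solPhi_le hz z' hε hδ) (exists_norm_solPsi_le hz z' hε))
    simpa using l1.sub l2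
  have h := integral_Ioi_of_hasDerivAt_of_tendsto'
    (fun T (hT : 1 ≤ T) => hasDerivAt_bilinear (z' := z') hz hx hy (by linarith : 0 < T))
    ((integrableOn_solPhi_solPsi hz z' hx hy).const_mul _) htop
  rw [integral_const_mul] at h
  simp only [mul_one] at h
  rw [eq_div_iff hxy']
  linear_combination -h

/-- Since `y = x` is not excluded, this provides the diagonal value, where the quotient by `x - y`
is undefined. -/
lemma continuousAt_integral_solPhi_solPsi (hz : -1 < z.re) (z' : ℂ) {x y : ℝ} (hx : 0 < x)
    (hy : 0 < y) :
    ContinuousAt (fun y => ∫ T in Ioi (1 : ℝ), solPhi z z' (x * T) * solPsi z z' (y * T)) y := by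
  set ε := min x (y / 2)
  have hε : 0 < ε := lt_min hx (half_pos hy)
  obtain ⟨C, -, hC⟩ := exists_norm_mul_le_of_exp_le hx (min_le_left x (y / 2)) hε
    (fun _ hδ => exists_norm_solPhi_le hz z' hε hδ) (exists_norm_solPsi_le hz z' hε)
  refine continuousAt_of_dominated (bound := fun T => C * Real.exp (-(ε / 4) * T)) ?_ ?_
    (integrableOn_exp_neg_mul_Ioi_one (by positivity) C) ?_
  · filter_upwards [Ioi_mem_nhds hy] with w hw
    exact (aestronglyMeasurable_comp_mul (continuousOn_solPhi hz z') hx).mul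
      (aestronglyMeasurable_comp_mul (continuousOn_solPsi z z') hw)
  · filter_upwards [Ioi_mem_nhds (half_lt_self hy)] with w (hw : y / 2 < w)
    filter_upwards [ae_restrict_mem measurableSet_Ioi] with T (hT : 1 < T)
    exact hC w ((min_le_right _ _).trans hw.le) T hT.le
  · filter_upwards [ae_restrict_mem measurableSet_Ioi] with T (hT : 1 < T)
    have hyT : 0 < y * T := mul_pos hy (by linarith)
    exact continuousAt_const.mul (ContinuousAt.comp (f := fun y => y * T)
      (hasDerivAt_solPsi z z' hyT).continuousAt (by fun_prop))

/-- With all signs taken `+`, the elementary prefactors combine with those of the Whittaker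
functions to `x^z` in `x` and `y^{-z'} e^{-y}` in `y`, the same for both products. -/
lemma formulaMM_eq (s : Fin 4 → ℤˣ) (z z' : ℂ) {x y : ℝ} (hx : 0 < x) (hy : 0 < y) :
    formulaMM s z z' x y = 1 / (Complex.Gamma (-z) * Complex.Gamma (-z')) *
      ((solE z z' x * solF z z' y - solPhi z z' x * solPsi z z' y) / ((x : ℂ) - y)) := by
  have hx' : (x : ℂ) ≠ 0 := by exact_mod_cast hx.ne'
  have hy' : (y : ℂ) ≠ 0 := by exact_mod_cast hy.ne'
  have hyarg : (y : ℂ).arg ≠ Real.pi := Complex.arg_ofReal_of_nonneg hy.le ▸ Real.pi_pos.ne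
  simp only [formulaMM, whittakerW_units_smul _ _ _ hx, whittakerW_units_smul _ _ _ hy,
    whittakerW_eq_kummerReg]
  rw [show (z - z') / 2 - (-z - z' + 1) / 2 - 1 / 2 = z - 1 by ring,
    show (z - z') / 2 + (-z - z' + 1) / 2 - 1 / 2 = -z' by ring,
    show (z - z') / 2 - (-z - z' - 1) / 2 - 1 / 2 = z by ring,
    show (z - z') / 2 + (-z - z' - 1) / 2 - 1 / 2 = -z' - 1 by ring]
  have hpx : (x : ℂ) ^ z = (x : ℂ) ^ ((z + z') / 2) * (x : ℂ) ^ (-(1 / 2) : ℂ) *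
      (x : ℂ) ^ ((z - z') / 2 + 1 / 2) := by
    rw [← Complex.cpow_add _ _ hx', ← Complex.cpow_add _ _ hx']
    congr 1
    ring
  have hpy : (y : ℂ) ^ (-z') = (y : ℂ) ^ (-((z + z') / 2)) * (y : ℂ) ^ (-(1 / 2) : ℂ) *
      (y : ℂ) ^ ((z - z') / 2 + 1 / 2) := by
    rw [← Complex.cpow_add _ _ hy', ← Complex.cpow_add _ _ hy']
    congr 1
    ring
  have hexp : Complex.exp (-(y : ℂ)) = Complex.exp (((x : ℂ) - y) / 2) *
      Complex.exp (-(x : ℂ) / 2) * Complex.exp (-(y : ℂ) / 2) := by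
    rw [← Complex.exp_add, ← Complex.exp_add]
    congr 1
    ring
  have hdiv : ((x / y : ℝ) : ℂ) ^ ((z + z') / 2) =
      (x : ℂ) ^ ((z + z') / 2) * (y : ℂ) ^ (-((z + z') / 2)) := by
    rw [div_eq_mul_inv, Complex.ofReal_mul, Complex.mul_cpow_ofReal_nonneg hx.le (by positivity),
      Complex.ofReal_inv, Complex.inv_cpow _ _ hyarg, Complex.cpow_neg]
  have hmul : ((x * y : ℝ) : ℂ) ^ (-(1 / 2) : ℂ) =
      (x : ℂ) ^ (-(1 / 2) : ℂ) * (y : ℂ) ^ (-(1 / 2) : ℂ) := by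
    rw [Complex.ofReal_mul, Complex.mul_cpow_ofReal_nonneg hx.le hy.le]
  rw [hdiv, hmul]
  simp only [solE, solF, solPhi, solPsi, gammaWeight]
  rw [hpx, hpy, hexp]
  ring

end System

/-! ### Evaluation of the generalized function `N` on test functions. -/

lemma measurable_kummerInt (a b : ℂ) : Measurable (kummerInt a b) := by
  have h : Measurable (Function.uncurry fun x τ : ℝ => kummerIntegrand a b x τ) := by
    unfold kummerIntegrand Function.uncurry; fun_prop
  exact (h.stronglyMeasurable.integral_prod_right
    (ν := volume.restrict (Ioi (0 : ℝ)))).measurable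

lemma measurable_convDensity (m c d : ℂ) : Measurable (convDensity m c d) :=
  (measurable_gammaWeight m).mul (measurable_kummerInt _ _)

/-- The one-variable convolution is applied in each variable. The pseudoconvolution nests both gamma
integrals outside both beta integrals, so the second gamma integral has to be exchanged with the
first beta integral. -/
lemma integral_gammaWeight_betaWeight_two {m c d m' c' d' : ℂ} (hm : -1 < m.re) (hc : -1 < c.re)
    (hd : -1 < d.re) (hm' : -1 < m'.re) (hc' : -1 < c'.re) (hd' : -1 < d'.re) {H : ℝ → ℝ → ℂ}
    (hH : Measurable (Function.uncurry H)) {M : ℝ} (hM : ∀ x y, ‖H x y‖ ≤ M) :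
    ∫ u in Ioi (0 : ℝ), gammaWeight m u * ∫ v in Ioi (0 : ℝ), gammaWeight m' v *
      ∫ p in Ioo (0 : ℝ) 1, betaWeight c d p * ∫ q in Ioo (0 : ℝ) 1, betaWeight c' d' q *
        H (u * p) (v * q) =
      ∫ x in Ioi (0 : ℝ), convDensity m c d x * ∫ y in Ioi (0 : ℝ), convDensity m' c' d' y *
        H x y := by
  have hM0 : 0 ≤ M := (norm_nonneg _).trans (hM 0 0)
  have hβ := integrableOn_betaWeight hc' hd'
  have hκ := integrableOn_convDensity hm' hc' hd'
  have hmeas1 : Measurable fun x => ∫ y in Ioi (0 : ℝ), convDensity m' c' d' y * H x y := by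
    have h : Measurable (Function.uncurry fun x y : ℝ => convDensity m' c' d' y * H x y) :=
      ((measurable_convDensity m' c' d').comp measurable_snd).mul hH
    exact (h.stronglyMeasurable.integral_prod_right
      (ν := volume.restrict (Ioi (0 : ℝ)))).measurable
  have hbd : ∀ (s : Set ℝ) (wt : ℝ → ℂ), IntegrableOn wt s → ∀ g : ℝ → ℂ, (∀ y, ‖g y‖ ≤ M) →
      ‖∫ y in s, wt y * g y‖ ≤ (∫ y in s, ‖wt y‖) * M := by
    intro s wt hwt g hg
    rw [← integral_mul_const]
    refine norm_integral_le_of_norm_le (hwt.norm.mul_const M) (Eventually.of_forall fun y => ?_)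
    rw [norm_mul]
    gcongr
    exact hg y
  rw [← integral_gammaWeight_betaWeight hm hc hd hmeas1
    (fun x _ => hbd _ _ hκ (H x) (hM x))]
  refine setIntegral_congr_fun measurableSet_Ioi fun u _ => ?_
  have hmeas2 : Measurable fun t : ℝ × ℝ =>
      ∫ q in Ioo (0 : ℝ) 1, betaWeight c' d' q * H (u * t.2) (t.1 * q) := by
    have h : Measurable (Function.uncurry fun (t : ℝ × ℝ) (q : ℝ) =>
        betaWeight c' d' q * H (u * t.2) (t.1 * q)) := by
      refine ((measurable_betaWeight c' d').comp measurable_snd).mul ?_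
      exact hH.comp (f := fun s : (ℝ × ℝ) × ℝ => (u * s.1.2, s.1.1 * s.2)) (by fun_prop)
    exact (h.stronglyMeasurable.integral_prod_right
      (ν := volume.restrict (Ioo (0 : ℝ) 1))).measurable
  have swap := integral_integral_swap (μ := volume.restrict (Ioi (0 : ℝ)))
    (ν := volume.restrict (Ioo (0 : ℝ) 1))
    (f := fun v p => gammaWeight m' v * betaWeight c d p *
      ∫ q in Ioo (0 : ℝ) 1, betaWeight c' d' q * H (u * p) (v * q))
    (((integrableOn_gammaWeight hm').mul_prod (integrableOn_betaWeight hc hd)).mul_bdd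
      hmeas2.aestronglyMeasurable (Eventually.of_forall fun t => hbd _ _ hβ _ fun q => hM _ _))
  simp only [mul_assoc, integral_const_mul] at swap
  rw [swap]
  congr 1
  refine setIntegral_congr_fun measurableSet_Ioo fun p _ => ?_
  rw [← integral_gammaWeight_betaWeight hm' hc' hd' (h := fun y => H (u * p) y)
    (hH.comp measurable_prodMk_left) (fun y _ => hM _ y), ← integral_const_mul]
  congr 1
  ext v
  ring

/-- The average of `g` over the segment from the origin to `(x, -y)`. -/
def segAvg (g : ℝ × ℝ → ℂ) (x y : ℝ) : ℂ := ∫ c in (0 : ℝ)..1, g (x * c, -(y * c))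

/-- `∂_y (y f(x, y))`. -/
def derivMulSnd (f : ℝ × ℝ → ℂ) (p : ℝ × ℝ) : ℂ := f p + p.2 * fderiv ℝ f p (0, 1)

lemma continuous_segAvg {g : ℝ × ℝ → ℂ} (hg : Continuous g) :
    Continuous (Function.uncurry (segAvg g)) := by
  unfold segAvg Function.uncurry
  refine intervalIntegral.continuous_parametric_intervalIntegral_of_continuous' ?_ 0 1
  unfold Function.uncurry
  fun_prop

lemma norm_segAvg_le {g : ℝ × ℝ → ℂ} {M : ℝ} (hM : ∀ p, ‖g p‖ ≤ M) (x y : ℝ) :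
    ‖segAvg g x y‖ ≤ M := by
  simpa [segAvg] using intervalIntegral.norm_integral_le_of_norm_le_const (a := 0) (b := 1)
    (f := fun c => g (x * c, -(y * c))) (fun c _ => hM _)

lemma continuous_fderiv_snd {f : ℝ × ℝ → ℂ} (hf : ContDiff ℝ ∞ f) :
    Continuous fun p => fderiv ℝ f p (0, 1) :=
  (hf.continuous_fderiv (by simp)).clm_apply continuous_const

lemma continuous_derivMulSnd {f : ℝ × ℝ → ℂ} (hf : ContDiff ℝ ∞ f) :
    Continuous (derivMulSnd f) := by
  have h1 := continuous_fderiv_snd hf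
  have h2 := hf.continuous
  unfold derivMulSnd
  fun_prop

lemma exists_norm_fderiv_snd_le {f : ℝ × ℝ → ℂ} (hf : ContDiff ℝ ∞ f)
    (hfs : HasCompactSupport f) : ∃ M : ℝ, ∀ p, ‖fderiv ℝ f p (0, 1)‖ ≤ M :=
  (continuous_fderiv_snd hf).bounded_above_of_compact_support
    (hfs.fderiv_apply (𝕜 := ℝ) (0, 1))

lemma exists_norm_derivMulSnd_le {f : ℝ × ℝ → ℂ} (hf : ContDiff ℝ ∞ f)
    (hfs : HasCompactSupport f) : ∃ M : ℝ, ∀ p, ‖derivMulSnd f p‖ ≤ M :=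
  (continuous_derivMulSnd hf).bounded_above_of_compact_support
    (hfs.add ((hfs.fderiv_apply (𝕜 := ℝ) (0, 1)).mul_left))

lemma hasDerivAt_segAvg {f : ℝ × ℝ → ℂ} (hf : ContDiff ℝ ∞ f) (hfs : HasCompactSupport f)
    (x y : ℝ) :
    HasDerivAt (segAvg f x)
      (∫ c in (0 : ℝ)..1, -(c : ℂ) * fderiv ℝ f (x * c, -(y * c)) (0, 1)) y := by
  obtain ⟨M, hM⟩ := exists_norm_fderiv_snd_le hf hfs
  have hc := hf.continuous
  have hc' := continuous_fderiv_snd hf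
  refine (intervalIntegral.hasDerivAt_integral_of_dominated_loc_of_deriv_le
    (F := fun y c => f (x * c, -(y * c)))
    (F' := fun y c => -(c : ℂ) * fderiv ℝ f (x * c, -(y * c)) (0, 1)) (bound := fun _ => M)
    (s := univ) univ_mem ?_ ?_ ?_ ?_ ?_ ?_).2
  · exact Eventually.of_forall fun y => Continuous.aestronglyMeasurable (by fun_prop)
  · exact Continuous.intervalIntegrable (by fun_prop) 0 1
  · refine Continuous.aestronglyMeasurable ?_
    exact (by fun_prop : Continuous fun c : ℝ => -(c : ℂ)).mul
      (hc'.comp (by fun_prop : Continuous fun c : ℝ => (x * c, -(y * c))))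
  · refine Eventually.of_forall fun c hc y _ => ?_
    rw [uIoc_of_le zero_le_one] at hc
    rw [norm_mul, norm_neg, Complex.norm_real, Real.norm_of_nonneg hc.1.le]
    exact (mul_le_of_le_one_left (norm_nonneg _) hc.2).trans (hM _)
  · simp
  · refine Eventually.of_forall fun c _ y _ => ?_
    have h1 : HasDerivAt (fun y : ℝ => (x * c, -(y * c))) ((0 : ℝ), -c) y :=
      (hasDerivAt_const y _).prodMk (by simpa using ((hasDerivAt_id y).mul_const c).fun_neg)
    have h2 := ((hf.differentiable (by simp)) (x * c, -(y * c))).hasFDerivAt.comp_hasDerivAt y h1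
    refine h2.congr_deriv ?_
    have h3 : ((0 : ℝ), -c) = (-c) • ((0 : ℝ), (1 : ℝ)) := by simp
    rw [h3, map_smul, Complex.real_smul]
    simp

lemma segAvg_add_mul_deriv {f : ℝ × ℝ → ℂ} (hf : ContDiff ℝ ∞ f) (x y : ℝ) :
    segAvg f x y + y * ∫ c in (0 : ℝ)..1, -(c : ℂ) * fderiv ℝ f (x * c, -(y * c)) (0, 1) =
      segAvg (derivMulSnd f) x y := by
  have hc := hf.continuous
  have hc' := (continuous_fderiv_snd hf).comp
      (by fun_prop : Continuous fun c : ℝ => (x * c, -(y * c)))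
  rw [segAvg, segAvg, ← intervalIntegral.integral_const_mul, ← intervalIntegral.integral_add]
  · congr 1
    ext c
    simp only [derivMulSnd]
    push_cast
    ring
  · exact Continuous.intervalIntegrable (by fun_prop) 0 1
  · refine Continuous.intervalIntegrable ?_ 0 1
    exact continuous_const.mul ((by fun_prop : Continuous fun c : ℝ => -(c : ℂ)).mul hc')

lemma hasDerivAt_mul_segAvg {f : ℝ × ℝ → ℂ} (hf : ContDiff ℝ ∞ f) (hfs : HasCompactSupport f)
    (x y : ℝ) :
    HasDerivAt (fun y : ℝ => (y : ℂ) * segAvg f x y) (segAvg (derivMulSnd f) x y) y := by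
  refine ((Complex.ofRealCLM.hasDerivAt (x := y)).mul
    (hasDerivAt_segAvg hf hfs x y)).congr_deriv ?_
  rw [← segAvg_add_mul_deriv hf]
  simp

/-- One regularisation step with `a = -z`, `b = z-1` has `a + b + 2 = 1`, and its factor `a + 1 = 1
- z` cancels against `Γ(2-z) = (1-z)Γ(1-z)`. The two terms then share one weight applied to `g + q
g' = (q g)'`, which for a segment average is the average of `∂_y(y f)`. -/
lemma betaPair_segAvg {f : ℝ × ℝ → ℂ} (hf : ContDiff ℝ ∞ f) (hfs : HasCompactSupport f)
    {z : ℂ} (hz : -1 < z.re) (hz0 : z.re < 0) (x v : ℝ) :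
    betaPair (-z) (z - 1) (fun q => segAvg f x (v * q)) =
      (Complex.Gamma (1 - z) * Complex.Gamma (1 + z))⁻¹ *
        ∫ q in Ioo (0 : ℝ) 1, betaWeight (-z) z q * segAvg (derivMulSnd f) x (v * q) := by
  have hk : ⌊-(-z).re⌋₊ = 0 := Nat.floor_eq_zero.2 (by simp; linarith)
  -- Since `-2 < Re (z-1) < -1`, exactly one regularisation step is taken.
  have hm : ⌊-(z - 1).re⌋₊ = 1 := by
    rw [Nat.floor_eq_iff (by simp; linarith)]
    simp only [Complex.sub_re, Complex.one_re, Nat.cast_one]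
    constructor <;> linarith
  obtain ⟨M, hM⟩ := hf.continuous.bounded_above_of_compact_support hfs
  obtain ⟨M', hM'⟩ := exists_norm_fderiv_snd_le hf hfs
  set D : ℝ → ℂ := fun y => ∫ c in (0 : ℝ)..1, -(c : ℂ) * fderiv ℝ f (x * c, -(y * c)) (0, 1)
    with hD
  have hderiv : deriv (fun q => segAvg f x (v * q)) = fun q => (v : ℂ) * D (v * q) := by
    ext q
    have h1 : HasDerivAt (fun q => v * q) v q := by simpa using (hasDerivAt_id q).const_mul v
    have h2 := ((hasDerivAt_segAvg hf hfs x (v * q)).scomp q h1).deriv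
    rw [Complex.real_smul] at h2
    exact h2
  have hDbd : ∀ y, ‖D y‖ ≤ M' := by
    intro y
    have := intervalIntegral.norm_integral_le_of_norm_le_const (a := 0) (b := 1) (C := M')
      (f := fun c : ℝ => -(c : ℂ) * fderiv ℝ f (x * c, -(y * c)) (0, 1)) (by
        intro c hc
        rw [uIoc_of_le zero_le_one] at hc
        rw [norm_mul, norm_neg, Complex.norm_real, Real.norm_of_nonneg hc.1.le]
        exact (mul_le_of_le_one_left (norm_nonneg _) hc.2).trans (hM' _))
    simpa [hD] using this
  have hDcont : Continuous D := by
    refine intervalIntegral.continuous_parametric_intervalIntegral_of_continuous' ?_ 0 1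
    exact (by fun_prop : Continuous fun s : ℝ × ℝ => -(s.2 : ℂ)).mul
      ((continuous_fderiv_snd hf).comp
        (by fun_prop : Continuous fun s : ℝ × ℝ => (x * s.2, -(s.1 * s.2))))
  have hGcont : Continuous fun q => segAvg f x (v * q) :=
    (continuous_segAvg hf.continuous).comp (by fun_prop : Continuous fun q : ℝ => (x, v * q))
  have hβ := integrableOn_betaWeight (c := -z) (d := z) (by simp; linarith) hz
  have hint1 : IntegrableOn (fun q => betaWeight (-z) z q * segAvg f x (v * q)) (Ioo 0 1) :=
    hβ.mul_bdd hGcont.aestronglyMeasurable (Eventually.of_forall fun q => norm_segAvg_le hM _ _)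
  have hint2 : IntegrableOn (fun q : ℝ => betaWeight (-z) z q * ((q : ℂ) * (v * D (v * q))))
      (Ioo 0 1) := by
    refine hβ.mul_bdd (c := |v| * M') (Continuous.aestronglyMeasurable (by fun_prop)) ?_
    filter_upwards [ae_restrict_mem measurableSet_Ioo] with q hq
    rw [norm_mul, norm_mul, Complex.norm_real, Complex.norm_real, Real.norm_of_nonneg hq.1.le,
      Real.norm_eq_abs]
    have h3 := hDbd (v * q)
    have h4 : 0 ≤ |v| * ‖D (v * q)‖ := by positivity
    refine (mul_le_of_le_one_left h4 hq.2.le).trans (by gcongr)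
  have hz1 : 1 - z ≠ 0 := fun h => by
    have := congrArg Complex.re h
    simp at this; linarith
  have hsplit : ∫ q in Ioo (0 : ℝ) 1, betaWeight (-z) z q * segAvg (derivMulSnd f) x (v * q)
      = (∫ q in Ioo (0 : ℝ) 1, betaWeight (-z) z q * segAvg f x (v * q)) +
        ∫ q in Ioo (0 : ℝ) 1, betaWeight (-z) z q * ((q : ℂ) * (v * D (v * q))) := by
    rw [← integral_add hint1 hint2]
    congr 1
    ext q
    rw [← segAvg_add_mul_deriv hf x (v * q), hD]
    push_cast
    ring
  rw [hsplit, betaPair, hk, hm, betaPairAux, betaPairAux, betaPairAux, hderiv, mul_add]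
  congr 1
  · rw [show -z + (z - 1) + 2 = 1 by ring, one_mul, ← integral_const_mul]
    refine setIntegral_congr_fun measurableSet_Ioo fun q _ => ?_
    simp only [betaWeight]
    rw [sub_add_cancel, show -z + 1 = 1 - z by ring, show z + 1 = 1 + z by ring]
    ring
  · rw [← integral_const_mul, ← integral_const_mul]
    refine setIntegral_congr_fun measurableSet_Ioo fun q hq => ?_
    have hq0 : (q : ℂ) ≠ 0 := by exact_mod_cast hq.1.ne'
    simp only [betaWeight]
    rw [sub_add_cancel, show -z + 1 = 1 - z by ring, show z + 1 = 1 + z by ring,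
      Complex.Gamma_add_one _ hz1, show 1 - z = -z + 1 by ring, Complex.cpow_add _ _ hq0,
      Complex.cpow_one]
    have hz2 : -z + 1 ≠ 0 := by rwa [show -z + 1 = 1 - z by ring]
    field_simp

/-- In the first variable both beta exponents `z` and `-z-1` exceed `-1`, so no regularisation
occurs. The whole singularity sits in the second variable, as the operator `∂_y(y·)` on the test
function. -/
lemma genN_eq {f : ℝ × ℝ → ℂ} (hf : ContDiff ℝ ∞ f) (hfs : HasCompactSupport f)
    {z z' : ℂ} (hz : -1 < z.re) (hz0 : z.re < 0) (hz' : -1 < z'.re) (hz0' : z'.re < 0) :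
    genN z z' (fun x y => f (x, y)) =
      z * z' * (Complex.Gamma (z' + 1) * Complex.Gamma (1 - z') * (Complex.Gamma (z + 1) *
        Complex.Gamma (-z)) * (Complex.Gamma (1 - z) * Complex.Gamma (1 + z)))⁻¹ *
      ∫ x in Ioi (0 : ℝ), convDensity z' z (-z - 1) x * ∫ y in Ioi (0 : ℝ),
        convDensity (-z') (-z) z y * segAvg (derivMulSnd f) x y := by
  obtain ⟨M, hM⟩ := exists_norm_derivMulSnd_le hf hfs
  have hk : ⌊-z.re⌋₊ = 0 := Nat.floor_eq_zero.2 (by linarith)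
  have hk' : ⌊-(-z - 1).re⌋₊ = 0 := Nat.floor_eq_zero.2 (by simp; linarith)
  have hβ : ∀ g, betaPair z (-z - 1) g = (Complex.Gamma (z + 1) * Complex.Gamma (-z))⁻¹ *
      ∫ p in Ioo (0 : ℝ) 1, betaWeight z (-z - 1) p * g p := by
    intro g
    rw [betaPair, hk, hk', betaPairAux, ← integral_const_mul, sub_add_cancel]
    congr 1
    ext p
    simp only [betaWeight]
    ring
  rw [← integral_gammaWeight_betaWeight_two hz' hz (by simp; linarith) (by simp; linarith)
    (by simp; linarith) hz (continuous_segAvg (continuous_derivMulSnd hf)).measurable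
    (fun x y => norm_segAvg_le hM x y)]
  -- By definition, the diagonal factor applied to the rescaled, reflected test function is its
  -- average over a segment from the origin.
  have h0 : genN z z' (fun x y => f (x, y)) =
      z * z' * gammaPair z' fun u => gammaPair (-z') fun v =>
      Complex.exp (-(u : ℂ) - (v : ℂ)) * betaPair z (-z - 1) fun p =>
        betaPair (-z) (z - 1) fun q => segAvg f (u * p) (v * q) := rfl
  rw [h0, mul_assoc (z * z')]
  congr 1
  rw [gammaPair_of_neg_one_lt hz', ← integral_const_mul, ← integral_const_mul]
  refine setIntegral_congr_fun measurableSet_Ioi fun u _ => ?_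
  rw [gammaPair_of_neg_one_lt (by simp; linarith), ← mul_assoc, ← mul_assoc, ← mul_assoc,
    ← integral_const_mul, ← integral_const_mul]
  refine setIntegral_congr_fun measurableSet_Ioi fun v _ => ?_
  simp only [hβ, betaPair_segAvg hf hfs hz hz0]
  rw [sub_eq_add_neg (-(u : ℂ)), Complex.exp_add, show -z' + 1 = 1 - z' by ring]
  simp only [mul_left_comm (betaWeight z _ _) (Complex.Gamma _ * Complex.Gamma _)⁻¹,
    integral_const_mul]
  simp only [gammaWeight, mul_inv]
  ring

/-! ### Moving the derivative off the test function in the second variable. -/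

section ByParts

variable {z z' : ℂ}

lemma convDensity_eq_solF (hz : -1 < z.re) (z' : ℂ) (y : ℝ) :
    convDensity (-z') (-z) z y = Complex.Gamma (z + 1) * solF z z' y := by
  have hG : Complex.Gamma (z + 1) ≠ 0 := Complex.Gamma_ne_zero_of_re_pos (by simp; linarith)
  rw [convDensity, solF, kummerReg_of_neg_one_lt hz, show -z' - -z - z - 1 = -z' - 1 by ring]
  field_simp

lemma integrableOn_solF (hz : -1 < z.re) (hz0 : z.re < 0) (hz0' : z'.re < 0) :
    IntegrableOn (solF z z') (Ioi 0) := by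
  have hG : Complex.Gamma (z + 1) ≠ 0 := Complex.Gamma_ne_zero_of_re_pos (by simp; linarith)
  have h := (integrableOn_convDensity (m := -z') (c := -z) (d := z) (by simp; linarith)
    (by simp; linarith) hz).const_mul (Complex.Gamma (z + 1))⁻¹
  refine h.congr (Eventually.of_forall fun y => ?_)
  dsimp only
  rw [convDensity_eq_solF hz, ← mul_assoc, inv_mul_cancel₀ hG, one_mul]

lemma norm_gammaWeight (m : ℂ) {x : ℝ} (hx : 0 < x) :
    ‖gammaWeight m x‖ = x ^ m.re * Real.exp (-x) := by
  rw [gammaWeight, norm_mul, Complex.norm_cpow_eq_rpow_re_of_pos hx, Complex.norm_exp]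
  simp

lemma exists_norm_kummerReg_le_rpow {a b : ℂ} (ha : -1 < a.re) (hb : b.re ≤ 0) :
    ∃ C : ℝ, 0 ≤ C ∧ ∀ y : ℝ, 0 < y → ‖kummerReg a b y‖ ≤ C * y ^ (-a.re - 1) := by
  have hG : 0 ≤ Real.Gamma (a.re + 1) := Real.Gamma_nonneg_of_nonneg (by linarith)
  refine ⟨‖(Complex.Gamma (a + 1))⁻¹‖ * Real.Gamma (a.re + 1), by positivity, fun y hy => ?_⟩
  rw [kummerReg_of_neg_one_lt ha, norm_mul, mul_assoc]
  gcongr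
  exact norm_kummerInt_le_rpow ha hb hy

lemma exists_norm_solF_le_rpow (hz : -1 < z.re) (hz' : -1 < z'.re) :
    ∃ C : ℝ, 0 ≤ C ∧ ∀ y : ℝ, 0 < y →
      ‖solF z z' y‖ ≤ C * (y ^ (-z'.re - z.re - 1) * Real.exp (-y)) := by
  obtain ⟨C, hC0, hC⟩ := exists_norm_kummerReg_le_rpow (b := -z' - 1) hz (by simp; linarith)
  refine ⟨C, hC0, fun y hy => ?_⟩
  rw [solF, norm_mul, norm_gammaWeight _ hy, Complex.neg_re]
  calc _ ≤ y ^ (-z'.re) * Real.exp (-y) * (C * y ^ (-z.re - 1)) := by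
        have := hC y hy
        gcongr
    _ = C * ((y ^ (-z'.re) * y ^ (-z.re - 1)) * Real.exp (-y)) := by ring
    _ = _ := by rw [← Real.rpow_add hy]; ring_nf

/-- The power bound on `kummerReg` requires exponents with `Re a > -1` and `Re b ≤ 0`, so `kummerReg
(z - 1) (-z')` is first rewritten by contiguous relations with second exponent `-z' - 1`. The
resulting worst power `-Re z' - Re z - 1` is integrable at 0 when both real parts are negative. -/
lemma exists_norm_solPsi_le_rpow (hz : -1 < z.re) (hz' : -1 < z'.re) :
    ∃ C : ℝ, 0 ≤ C ∧ ∀ y : ℝ, 0 < y → ‖solPsi z z' y‖ ≤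
      C * (y ^ (-z'.re - z.re) * Real.exp (-y) + y ^ (-z'.re - z.re - 1) * Real.exp (-y)) := by
  obtain ⟨C₁, h₁, hC₁⟩ := exists_norm_kummerReg_le_rpow (b := -z' - 1) hz (by simp; linarith)
  obtain ⟨C₂, h₂, hC₂⟩ := exists_norm_kummerReg_le_rpow (a := z + 1) (b := -z' - 1)
    (by simp; linarith) (by simp; linarith)
  refine ⟨C₁ + ‖z + 1‖ * C₂ + ‖z'‖ * C₁, by positivity, fun y hy => ?_⟩
  have hy' : y ≠ 0 := hy.ne'
  have e : kummerReg (z - 1) (-z') y = y * (kummerReg z (-z' - 1) y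
      + (z + 1) * kummerReg (z + 1) (-z' - 1) y) + z' * kummerReg z (-z' - 1) y := by
    have h1 := kummerReg_by_parts (z - 1) (-z') hy
    have h2 := kummerReg_add_one hz (-z' - 1) hy
    rw [sub_add_cancel] at h1 h2
    linear_combination h1 + (y : ℂ) * h2
  have b1 := hC₁ y hy
  have b2 := hC₂ y hy
  have p1 : y * y ^ (-z.re - 1) = y ^ (-z.re) := by
    rw [Real.rpow_sub_one hy']; field_simp
  have p2 : y * y ^ (-(z + 1).re - 1) = y ^ (-z.re - 1) := by
    rw [Real.rpow_sub_one hy']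
    simp only [Complex.add_re, Complex.one_re, neg_add']
    field_simp
  have hnorm : ‖kummerReg (z - 1) (-z') y‖ ≤
      C₁ * y ^ (-z.re) + (‖z + 1‖ * C₂ + ‖z'‖ * C₁) * y ^ (-z.re - 1) := by
    rw [e]
    refine (norm_add_le _ _).trans ?_
    rw [norm_mul, norm_mul, Complex.norm_real, Real.norm_of_nonneg hy.le]
    have b3 : ‖kummerReg z (-z' - 1) y + (z + 1) * kummerReg (z + 1) (-z' - 1) y‖ ≤
        C₁ * y ^ (-z.re - 1) + ‖z + 1‖ * (C₂ * y ^ (-(z + 1).re - 1)) := by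
      refine (norm_add_le _ _).trans ?_
      rw [norm_mul]
      gcongr
    calc _ ≤ y * (C₁ * y ^ (-z.re - 1) + ‖z + 1‖ * (C₂ * y ^ (-(z + 1).re - 1)))
          + ‖z'‖ * (C₁ * y ^ (-z.re - 1)) := by gcongr
      _ = C₁ * (y * y ^ (-z.re - 1)) + ‖z + 1‖ * C₂ * (y * y ^ (-(z + 1).re - 1))
          + ‖z'‖ * C₁ * y ^ (-z.re - 1) := by ring
      _ = _ := by rw [p1, p2]; ring
  rw [solPsi, norm_mul, norm_gammaWeight _ hy, Complex.neg_re]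
  have q1 : y ^ (-z'.re - z.re) = y ^ (-z'.re) * y ^ (-z.re) := by
    rw [← Real.rpow_add hy]; ring_nf
  have q2 : y ^ (-z'.re - z.re - 1) = y ^ (-z'.re) * y ^ (-z.re - 1) := by
    rw [← Real.rpow_add hy]; ring_nf
  rw [q1, q2]
  set P := y ^ (-z.re)
  set Q := y ^ (-z.re - 1)
  have hP : 0 ≤ P := Real.rpow_nonneg hy.le _
  have hQ : 0 ≤ Q := Real.rpow_nonneg hy.le _
  have hle : C₁ * P + (‖z + 1‖ * C₂ + ‖z'‖ * C₁) * Q ≤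
      (C₁ + ‖z + 1‖ * C₂ + ‖z'‖ * C₁) * (P + Q) := by
    have : 0 ≤ (‖z + 1‖ * C₂ + ‖z'‖ * C₁) * P + C₁ * Q := by positivity
    linarith
  calc _ ≤ y ^ (-z'.re) * Real.exp (-y) * ((C₁ + ‖z + 1‖ * C₂ + ‖z'‖ * C₁) * (P + Q)) := by
        gcongr
        exact hnorm.trans hle
    _ = _ := by ring

lemma integrableOn_rpow_mul_exp_neg {s : ℝ} (hs : -1 < s) :
    IntegrableOn (fun y : ℝ => y ^ s * Real.exp (-y)) (Ioi 0) := by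
  simpa using integrableOn_rpow_mul_exp_neg_mul_rpow hs one_pos one_pos

lemma integrableOn_solPsi (hz : -1 < z.re) (hz0 : z.re < 0) (hz' : -1 < z'.re) (hz0' : z'.re < 0) :
    IntegrableOn (solPsi z z') (Ioi 0) := by
  obtain ⟨C, -, hC⟩ := exists_norm_solPsi_le_rpow hz hz'
  refine Integrable.mono' (((integrableOn_rpow_mul_exp_neg (s := -z'.re - z.re) (by linarith)).add
    (integrableOn_rpow_mul_exp_neg (s := -z'.re - z.re - 1) (by linarith))).const_mul C :
      Integrable (fun y : ℝ => C * (y ^ (-z'.re - z.re) * Real.exp (-y)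
        + y ^ (-z'.re - z.re - 1) * Real.exp (-y))) (volume.restrict (Ioi 0)))
    ((continuousOn_solPsi z z').aestronglyMeasurable measurableSet_Ioi) ?_
  filter_upwards [ae_restrict_mem measurableSet_Ioi] with y hy
  exact hC y hy

/-- Integration by parts, using `(y segAvg f)' = segAvg (∂_y(y f))` and `y solF' = -solPsi`. The
boundary terms vanish because `y solF(y)` is bounded by a multiple of `y^{-Re z - Re z'} e^{-y}`,
whose exponent is positive. -/
lemma integral_solF_segAvg (hz : -1 < z.re) (hz0 : z.re < 0) (hz' : -1 < z'.re) (hz0' : z'.re < 0)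
    {f : ℝ × ℝ → ℂ} (hf : ContDiff ℝ ∞ f) (hfs : HasCompactSupport f) (x : ℝ) :
    ∫ y in Ioi (0 : ℝ), solF z z' y * segAvg (derivMulSnd f) x y =
      ∫ y in Ioi (0 : ℝ), solPsi z z' y * segAvg f x y := by
  obtain ⟨M, hM⟩ := hf.continuous.bounded_above_of_compact_support hfs
  obtain ⟨M', hM'⟩ := exists_norm_derivMulSnd_le hf hfs
  have hM0 : 0 ≤ M := (norm_nonneg _).trans (hM 0)
  have hG : ∀ {g : ℝ × ℝ → ℂ}, Continuous g → Continuous (segAvg g x) := fun hg =>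
    (continuous_segAvg hg).comp (by fun_prop : Continuous fun y : ℝ => (x, y))
  have e : ∀ y ∈ Ioi (0 : ℝ), -solPsi z z' y / y * ((y : ℂ) * segAvg f x y) =
      -(solPsi z z' y * segAvg f x y) := by
    intro y (hy : 0 < y)
    have : (y : ℂ) ≠ 0 := by exact_mod_cast hy.ne'
    field_simp
  have hi : IntegrableOn (fun y => solPsi z z' y * segAvg f x y) (Ioi 0) :=
    (integrableOn_solPsi hz hz0 hz' hz0').mul_bdd (hG hf.continuous).aestronglyMeasurable
      (Eventually.of_forall fun y => norm_segAvg_le hM x y)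
  obtain ⟨C, hC0, hC⟩ := exists_norm_solF_le_rpow hz hz'
  have hbd : ∀ y : ℝ, 0 < y → ‖solF z z' y * ((y : ℂ) * segAvg f x y)‖ ≤
      C * M * (y ^ (-z'.re - z.re) * Real.exp (-y)) := by
    intro y hy
    rw [norm_mul, norm_mul, Complex.norm_real, Real.norm_of_nonneg hy.le]
    have h1 := hC y hy
    have h2 := norm_segAvg_le hM x y
    calc _ ≤ C * (y ^ (-z'.re - z.re - 1) * Real.exp (-y)) * (y * M) := by gcongr
      _ = C * M * ((y ^ (-z'.re - z.re - 1) * y) * Real.exp (-y)) := by ring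
      _ = _ := by rw [← Real.rpow_add_one hy.ne', sub_add_cancel]
  have h0 : Tendsto (solF z z' * fun y : ℝ => (y : ℂ) * segAvg f x y) (𝓝[>] 0) (𝓝 0) := by
    have hlim : Tendsto (fun y : ℝ => C * M * (y ^ (-z'.re - z.re) * Real.exp (-y)))
        (𝓝[>] 0) (𝓝 0) := by
      have hc : ContinuousAt (fun y : ℝ => C * M * (y ^ (-z'.re - z.re) * Real.exp (-y))) 0 :=
        continuousAt_const.mul ((Real.continuousAt_rpow_const 0 _ (Or.inr (by linarith))).mul
          (by fun_prop))
      have h := hc.tendsto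
      rw [Real.zero_rpow (by linarith), zero_mul, mul_zero] at h
      exact h.mono_left nhdsWithin_le_nhds
    refine squeeze_zero_norm' ?_ hlim
    filter_upwards [self_mem_nhdsWithin] with y hy using hbd y hy
  have h1 : Tendsto (solF z z' * fun y : ℝ => (y : ℂ) * segAvg f x y) atTop (𝓝 0) := by
    have hlim : Tendsto (fun y : ℝ => C * M * (y ^ (-z'.re - z.re) * Real.exp (-y)))
        atTop (𝓝 0) := by
      have := tendsto_rpow_mul_exp_neg_mul_atTop_nhds_zero (-z'.re - z.re) 1 one_pos
      simpa using this.const_mul (C * M)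
    refine squeeze_zero_norm' ?_ hlim
    filter_upwards [eventually_gt_atTop 0] with y hy using hbd y hy
  have h := integral_Ioi_mul_deriv_eq_deriv_mul
    (fun y hy => hasDerivAt_solF (z' := z') hz hy)
    (fun y _ => hasDerivAt_mul_segAvg hf hfs x y)
    ((integrableOn_solF hz hz0 hz0').mul_bdd
      (hG (continuous_derivMulSnd hf)).aestronglyMeasurable
      (Eventually.of_forall fun y => norm_segAvg_le hM' x y))
    ((integrableOn_congr_fun (f := (fun y => -solPsi z z' y / y) * fun y : ℝ =>
      (y : ℂ) * segAvg f x y) e measurableSet_Ioi).2 hi.neg) h0 h1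
  rw [h, setIntegral_congr_fun measurableSet_Ioi e, integral_neg]
  simp

end ByParts

/-! ### Averaging a product density over dilations. -/

/-- An integrable function on the line that vanishes for `x ≤ 0`, is continuous for `x > 0`, and
decays exponentially. -/
structure IsHalfLineDensity (A : ℝ → ℂ) : Prop where
  measurable : Measurable A
  integrable : Integrable A
  eq_zero : ∀ x, x ≤ 0 → A x = 0
  continuousOn : ContinuousOn A (Ioi 0)
  decay : ∀ ε : ℝ, 0 < ε → ∃ C : ℝ, 0 ≤ C ∧ ∀ x, ε ≤ x → ‖A x‖ ≤ C * Real.exp (-(x / 2))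

lemma IsHalfLineDensity.of_continuousOn {f : ℝ → ℂ} (hc : ContinuousOn f (Ioi 0))
    (hi : IntegrableOn f (Ioi 0))
    (hd : ∀ ε : ℝ, 0 < ε → ∃ C : ℝ, 0 ≤ C ∧ ∀ x, ε ≤ x → ‖f x‖ ≤ C * Real.exp (-(x / 2))) :
    IsHalfLineDensity ((Ioi 0).indicator f) where
  measurable := by
    classical
    rw [← piecewise_eq_indicator]
    exact hc.measurable_piecewise continuousOn_const measurableSet_Ioi
  integrable := hi.integrable_indicator measurableSet_Ioi
  eq_zero x hx := indicator_of_notMem (by simpa using hx) f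
  continuousOn := hc.congr fun x hx => indicator_of_mem hx f
  decay ε hε := by
    obtain ⟨C, hC0, hC⟩ := hd ε hε
    refine ⟨C, hC0, fun x hx => ?_⟩
    rw [indicator_of_mem (mem_Ioi.2 (hε.trans_le hx))]
    exact hC x hx

/-- The density at `(x, y)`, `x > 0 > y`, of the pseudoconvolution of `A(x) B(-y)` and the uniform
measure on the segment from `(0, 0)` to `(1, 1)`. -/
def dilationKernel (A B : ℝ → ℂ) (x y : ℝ) : ℂ :=
  ∫ T in Ioi (1 : ℝ), A (x * T) * B (-(y * T))

section Kernel

variable {A B : ℝ → ℂ}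

lemma dilationKernel_eq_zero (hA : IsHalfLineDensity A) (hB : IsHalfLineDensity B) (x y : ℝ)
    (h : x ≤ 0 ∨ 0 ≤ y) : dilationKernel A B x y = 0 := by
  refine setIntegral_eq_zero_of_forall_eq_zero fun T (hT : 1 < T) => ?_
  rcases h with h | h
  · rw [hA.eq_zero (x * T) (mul_nonpos_of_nonpos_of_nonneg h (by linarith)), zero_mul]
  · rw [hB.eq_zero (-(y * T)) (neg_nonpos.2 (mul_nonneg h (by linarith))), mul_zero]

lemma norm_mul_le_exp {C₁ C₂ ε : ℝ} (h₁ : 0 ≤ C₁)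
    (hA : ∀ x, ε ≤ x → ‖A x‖ ≤ C₁ * Real.exp (-(x / 2)))
    (hB : ∀ x, ε ≤ x → ‖B x‖ ≤ C₂ * Real.exp (-(x / 2))) (hε : 0 < ε) {x y T : ℝ} (hx : ε ≤ x)
    (hy : ε ≤ y) (hT : 1 ≤ T) : ‖A (x * T) * B (y * T)‖ ≤ C₁ * C₂ * Real.exp (-ε * T) := by
  have e1 := hA (x * T) (by nlinarith)
  have e2 := hB (y * T) (by nlinarith)
  rw [norm_mul]
  have e3 : Real.exp (-(x * T / 2)) * Real.exp (-(y * T / 2)) ≤ Real.exp (-ε * T) := by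
    rw [← Real.exp_add]
    exact Real.exp_le_exp.2 (by nlinarith)
  have h₂ : 0 ≤ C₂ := by
    by_contra hneg
    have h3 := hB ε le_rfl
    have h4 := Real.exp_pos (-(ε / 2))
    have := norm_nonneg (B ε)
    nlinarith
  calc _ ≤ (C₁ * Real.exp (-(x * T / 2))) * (C₂ * Real.exp (-(y * T / 2))) := by gcongr
    _ = C₁ * C₂ * (Real.exp (-(x * T / 2)) * Real.exp (-(y * T / 2))) := by ring
    _ ≤ _ := by gcongr

lemma continuousOn_dilationKernel (hA : IsHalfLineDensity A) (hB : IsHalfLineDensity B) :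
    ContinuousOn (fun p : ℝ × ℝ => dilationKernel A B p.1 p.2) (Ioi 0 ×ˢ Iio 0) := by
  rintro ⟨x, y⟩ ⟨hx, hy⟩
  have hx : 0 < x := hx
  have hy : y < 0 := hy
  set ε := min (x / 2) (-y / 2)
  have hε : 0 < ε := lt_min (by linarith) (by linarith)
  obtain ⟨C₁, h₁, hC₁⟩ := hA.decay ε hε
  obtain ⟨C₂, -, hC₂⟩ := hB.decay ε hε
  refine ContinuousAt.continuousWithinAt ?_
  refine continuousAt_of_dominated (bound := fun T => C₁ * C₂ * Real.exp (-ε * T)) ?_ ?_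
    (integrableOn_exp_neg_mul_Ioi_one hε _) ?_
  · refine Eventually.of_forall fun p => ?_
    exact ((hA.measurable.comp (by fun_prop)).mul
      (hB.measurable.comp (by fun_prop))).aestronglyMeasurable
  · have h1 : ∀ᶠ p : ℝ × ℝ in 𝓝 (x, y), x / 2 < p.1 :=
      continuousAt_fst.eventually_const_lt (half_lt_self hx)
    have h2 : ∀ᶠ p : ℝ × ℝ in 𝓝 (x, y), p.2 < y / 2 :=
      continuousAt_snd.eventually_lt_const (by simp; linarith)
    filter_upwards [h1, h2] with p hp1 hp2
    filter_upwards [ae_restrict_mem measurableSet_Ioi] with T (hT : 1 < T)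
    rw [← neg_mul]
    exact norm_mul_le_exp h₁ hC₁ hC₂ hε ((min_le_left _ _).trans hp1.le)
      ((min_le_right _ _).trans (by linarith)) hT.le
  · filter_upwards [ae_restrict_mem measurableSet_Ioi] with T (hT : 1 < T)
    have hxT : 0 < x * T := mul_pos hx (by linarith)
    have hyT : 0 < -(y * T) := neg_pos.2 (mul_neg_of_neg_of_pos hy (by linarith))
    refine ContinuousAt.mul ?_ ?_
    · exact ContinuousAt.comp (f := fun p : ℝ × ℝ => p.1 * T)
        (hA.continuousOn.continuousAt (Ioi_mem_nhds hxT)) (by fun_prop)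
    · exact ContinuousAt.comp (f := fun p : ℝ × ℝ => -(p.2 * T))
        (hB.continuousOn.continuousAt (Ioi_mem_nhds hyT)) (by fun_prop)

lemma integrable_dilation_pair (hA : IsHalfLineDensity A) (hB : IsHalfLineDensity B) {T : ℝ}
    (hT : 0 < T) : Integrable fun p : ℝ × ℝ => A (p.1 * T) * B (-(p.2 * T)) := by
  -- The negative scale factor accounts for the reflection `y ↦ -y` in the second variable.
  have h2 := hB.integrable.comp_mul_right' (R := -T) (by linarith)
  simp only [mul_neg] at h2
  exact (hA.integrable.comp_mul_right' hT.ne').mul_prod h2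

/-- For fixed `T` the norm in `L¹` of the plane scales by `T⁻²`, which is integrable over `T > 1`.
This makes the kernel integrable on the plane and licenses the later exchanges of integrals. -/
lemma integrable_dilation_triple (hA : IsHalfLineDensity A) (hB : IsHalfLineDensity B) :
    Integrable (fun t : ℝ × (ℝ × ℝ) => A (t.2.1 * t.1) * B (-(t.2.2 * t.1)))
      ((volume.restrict (Ioi 1)).prod volume) := by
  have hmeas : Measurable fun t : ℝ × (ℝ × ℝ) => A (t.2.1 * t.1) * B (-(t.2.2 * t.1)) :=
    (hA.measurable.comp (by fun_prop)).mul (hB.measurable.comp (by fun_prop))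
  rw [integrable_prod_iff hmeas.aestronglyMeasurable]
  constructor
  · filter_upwards [ae_restrict_mem measurableSet_Ioi] with T (hT : 1 < T)
    exact integrable_dilation_pair hA hB (by linarith)
  · refine ((integrableOn_Ioi_rpow_of_lt (by norm_num : (-2 : ℝ) < -1) one_pos).const_mul
      ((∫ x, ‖A x‖) * ∫ y, ‖B y‖)).congr ?_
    filter_upwards [ae_restrict_mem measurableSet_Ioi] with T (hT : 1 < T)
    have hT0 : 0 < T := by linarith
    simp only [norm_mul]
    have e1 := Measure.integral_comp_mul_right (fun x => ‖A x‖) T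
    have e2 := Measure.integral_comp_mul_right (fun x => ‖B x‖) (-T)
    simp only [mul_neg, smul_eq_mul] at e1 e2
    rw [Measure.volume_eq_prod, integral_prod_mul (fun x => ‖A (x * T)‖) (fun y => ‖B (-(y * T))‖),
      e1, e2, abs_inv, abs_inv, abs_neg, abs_of_pos hT0, Real.rpow_neg hT0.le, Real.rpow_ofNat]
    field_simp

lemma integrable_dilationKernel (hA : IsHalfLineDensity A) (hB : IsHalfLineDensity B) :
    Integrable fun p : ℝ × ℝ => dilationKernel A B p.1 p.2 :=
  (integrable_dilation_triple hA hB).integral_prod_right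

lemma integral_Ioi_one_inv (Ψ : ℝ → ℂ) :
    ∫ T in Ioi (1 : ℝ), ((T ^ 2)⁻¹ : ℝ) • Ψ T⁻¹ = ∫ c in (0 : ℝ)..1, Ψ c := by
  have himg : (fun T : ℝ => T⁻¹) '' Ioi 1 = Ioo 0 1 := by
    have := inv_Ioi₀ (one_pos : (0 : ℝ) < 1)
    rw [← image_inv_eq_inv, inv_one] at this
    exact this
  rw [intervalIntegral.integral_of_le zero_le_one, integral_Ioc_eq_integral_Ioo, ← himg,
    integral_image_eq_integral_abs_deriv_smul measurableSet_Ioi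
    (fun T (hT : 1 < T) => (hasDerivAt_inv (by linarith : T ≠ 0)).hasDerivWithinAt)
    inv_injective.injOn]
  refine setIntegral_congr_fun measurableSet_Ioi fun T _ => ?_
  rw [abs_neg, abs_of_nonneg (by positivity)]

lemma integral_dilation_mul (hA : IsHalfLineDensity A) (hB : IsHalfLineDensity B)
    {f : ℝ × ℝ → ℂ} (hf : Continuous f) {M : ℝ} (hM : ∀ p, ‖f p‖ ≤ M) {T : ℝ} (hT : 0 < T) :
    ∫ p : ℝ × ℝ, A (p.1 * T) * B (-(p.2 * T)) * f p =
      ((T ^ 2)⁻¹ : ℝ) • ∫ p : ℝ × ℝ, A p.1 * B p.2 * f (p.1 * T⁻¹, -(p.2 * T⁻¹)) := by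
  have hT' : T ≠ 0 := hT.ne'
  have i1 : Integrable fun p : ℝ × ℝ => A (p.1 * T) * B (-(p.2 * T)) * f p :=
    (integrable_dilation_pair hA hB hT).mul_bdd hf.aestronglyMeasurable
      (Eventually.of_forall hM)
  have i2 : Integrable fun p : ℝ × ℝ => A p.1 * B p.2 * f (p.1 * T⁻¹, -(p.2 * T⁻¹)) :=
    (hA.integrable.mul_prod hB.integrable).mul_bdd
      (Continuous.aestronglyMeasurable (by fun_prop)) (Eventually.of_forall fun p => hM _)
  rw [Measure.volume_eq_prod] at i1 i2 ⊢
  rw [integral_prod _ i1, integral_prod _ i2]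
  have e1 : ∀ x : ℝ, ∫ y, A (x * T) * B (-(y * T)) * f (x, y) =
      T⁻¹ • ∫ y, A (x * T) * B y * f (x * T * T⁻¹, -(y * T⁻¹)) := by
    intro x
    have h := Measure.integral_comp_mul_right
      (fun y => A (x * T) * B y * f (x * T * T⁻¹, -(y * T⁻¹))) (-T)
    rw [abs_inv, abs_neg, abs_of_pos hT] at h
    rw [← h]
    congr 1
    ext y
    rw [mul_neg, neg_mul, neg_neg, mul_inv_cancel_right₀ hT', mul_inv_cancel_right₀ hT']
  simp only [e1]
  have h := Measure.integral_comp_mul_right (fun x => ∫ y, A x * B y * f (x * T⁻¹, -(y * T⁻¹))) T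
  rw [abs_inv, abs_of_pos hT] at h
  rw [integral_smul, h, smul_smul]
  congr 1
  ring

/-- Undoing the dilation moves it to the test function with Jacobian `T⁻²`, and `c = 1/T` turns `T⁻²
dT` into `dc` on `(0,1)`. So integrating over `T > 1` amounts to averaging over the segment. -/
lemma integral_dilationKernel_mul (hA : IsHalfLineDensity A) (hB : IsHalfLineDensity B)
    {f : ℝ × ℝ → ℂ} (hf : Continuous f) {M : ℝ} (hM : ∀ p, ‖f p‖ ≤ M) :
    ∫ p : ℝ × ℝ, dilationKernel A B p.1 p.2 * f p =
      ∫ x : ℝ, A x * ∫ y : ℝ, B y * segAvg f x y := by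
  have swap1 := integral_integral_swap (μ := volume.restrict (Ioi (1 : ℝ)))
    (ν := (volume : Measure (ℝ × ℝ)))
    (f := fun T p => A (p.1 * T) * B (-(p.2 * T)) * f p)
    ((integrable_dilation_triple hA hB).mul_bdd (c := M) (g := fun t : ℝ × (ℝ × ℝ) => f t.2)
      (Continuous.aestronglyMeasurable (by fun_prop)) (Eventually.of_forall fun t => hM t.2))
  simp only [integral_mul_const] at swap1
  unfold dilationKernel
  rw [← swap1, setIntegral_congr_fun measurableSet_Ioi fun T (hT : (1 : ℝ) < T) =>
    integral_dilation_mul hA hB hf hM (by linarith : 0 < T),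
    integral_Ioi_one_inv fun c => ∫ p : ℝ × ℝ, A p.1 * B p.2 * f (p.1 * c, -(p.2 * c)),
    intervalIntegral.integral_of_le zero_le_one]
  have hAB : Integrable fun p : ℝ × ℝ => A p.1 * B p.2 := hA.integrable.mul_prod hB.integrable
  have i2 : Integrable (fun t : ℝ × (ℝ × ℝ) => (1 : ℂ) * (A t.2.1 * B t.2.2) *
      f (t.2.1 * t.1, -(t.2.2 * t.1))) ((volume.restrict (Ioc 0 1)).prod volume) :=
    ((integrable_const (1 : ℂ)).mul_prod hAB).mul_bdd (c := M)
      (Continuous.aestronglyMeasurable (by fun_prop)) (Eventually.of_forall fun t => hM _)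
  simp only [one_mul] at i2
  rw [integral_integral_swap (f := fun (c : ℝ) (p : ℝ × ℝ) => A p.1 * B p.2 *
      f (p.1 * c, -(p.2 * c))) i2]
  have e : ∀ p : ℝ × ℝ, ∫ c in Ioc (0 : ℝ) 1, A p.1 * B p.2 * f (p.1 * c, -(p.2 * c)) =
      A p.1 * B p.2 * segAvg f p.1 p.2 := by
    intro p
    rw [integral_const_mul, segAvg, intervalIntegral.integral_of_le zero_le_one]
  simp only [e]
  have i3 : Integrable fun p : ℝ × ℝ => A p.1 * B p.2 * segAvg f p.1 p.2 :=
    hAB.mul_bdd (continuous_segAvg hf).aestronglyMeasurable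
      (Eventually.of_forall fun p => norm_segAvg_le hM _ _)
  rw [Measure.volume_eq_prod] at i3 ⊢
  rw [integral_prod _ i3]
  simp only [mul_assoc, integral_const_mul]

/-- With `y` fixed, only one factor `T⁻¹` would come from integrating in `r`, which is not enough.
Convergence in `T` comes instead from the exponential decay of `B(yT)`. -/
lemma integrable_dilation_div (hA : IsHalfLineDensity A) (hB : IsHalfLineDensity B) {x y : ℝ}
    (hx : 0 < x) (hy : 0 < y) :
    Integrable (fun t : ℝ × ℝ => A (t.2 * t.1) * B (y * t.1) * (1 / ((t.2 + x : ℝ) : ℂ)))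
      ((volume.restrict (Ioi 1)).prod (volume.restrict (Ioi 0))) := by
  have hmeas : Measurable fun t : ℝ × ℝ => A (t.2 * t.1) * B (y * t.1) :=
    (hA.measurable.comp (by fun_prop)).mul (hB.measurable.comp (by fun_prop))
  have h1 : Integrable (fun t : ℝ × ℝ => A (t.2 * t.1) * B (y * t.1))
      ((volume.restrict (Ioi 1)).prod (volume.restrict (Ioi 0))) := by
    rw [integrable_prod_iff hmeas.aestronglyMeasurable]
    constructor
    · filter_upwards [ae_restrict_mem measurableSet_Ioi] with T (hT : 1 < T)
      exact ((hA.integrable.comp_mul_right' (by linarith : T ≠ 0)).mul_const _).integrableOn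
    · obtain ⟨C, hC0, hC⟩ := hB.decay y hy
      have hm : Measurable fun T : ℝ => ∫ r in Ioi (0 : ℝ), ‖A (r * T) * B (y * T)‖ :=
        (StronglyMeasurable.integral_prod_right (ν := volume.restrict (Ioi (0 : ℝ)))
          (f := fun T r : ℝ => ‖A (r * T) * B (y * T)‖) hmeas.norm.stronglyMeasurable).measurable
      refine Integrable.mono' ((integrableOn_exp_neg_mul_Ioi_one (half_pos hy)
        ((∫ r, ‖A r‖) * C))) hm.aestronglyMeasurable ?_
      filter_upwards [ae_restrict_mem measurableSet_Ioi] with T (hT : 1 < T)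
      have hT0 : 0 < T := by linarith
      rw [Real.norm_of_nonneg (by positivity)]
      simp only [norm_mul]
      rw [integral_mul_const]
      have e1 : ∫ r in Ioi (0 : ℝ), ‖A (r * T)‖ ≤ ∫ r, ‖A r‖ := by
        refine (setIntegral_le_integral (hA.integrable.comp_mul_right' hT0.ne').norm
          (Eventually.of_forall fun r => norm_nonneg _)).trans ?_
        rw [Measure.integral_comp_mul_right (fun r => ‖A r‖) T, smul_eq_mul,
          abs_of_pos (inv_pos.2 hT0)]
        exact mul_le_of_le_one_left (by positivity) (inv_le_one_of_one_le₀ hT.le)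
      have e2 := hC (y * T) (by nlinarith)
      rw [show -(y * T / 2) = -(y / 2) * T by ring] at e2
      rw [mul_assoc]
      gcongr
  refine h1.mul_bdd (c := 1 / x) (Measurable.aestronglyMeasurable (by fun_prop)) ?_
  rw [Measure.prod_restrict]
  filter_upwards [ae_restrict_mem (measurableSet_Ioi.prod measurableSet_Ioi)] with t ht
  have ht2 : 0 < t.2 := ht.2
  rw [norm_div, norm_one, Complex.norm_real, Real.norm_of_nonneg (by positivity)]
  exact one_div_le_one_div_of_le hx (by linarith)

lemma integrableOn_dilationKernel_div (hA : IsHalfLineDensity A) (hB : IsHalfLineDensity B)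
    {x y : ℝ} (hx : 0 < x) (hy : 0 < y) :
    IntegrableOn (fun r : ℝ => dilationKernel A B r (-y) * (1 / ((r + x : ℝ) : ℂ))) (Ioi 0) := by
  have h := (integrable_dilation_div hA hB hx hy).integral_prod_right
  simp only [integral_mul_const] at h
  simp only [dilationKernel, neg_mul, neg_neg]
  exact h

/-- Replacing `r` by `r/T` turns `1/(r+x)` into `T/(r+xT)`, and the factor `T` cancels the Jacobian.
Thus the transform of a dilate of `A` is the transform of `A` at `xT`. -/
lemma integral_dilationKernel_div (hA : IsHalfLineDensity A) (hB : IsHalfLineDensity B)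
    {x y : ℝ} (hx : 0 < x) (hy : 0 < y) :
    ∫ r in Ioi (0 : ℝ), dilationKernel A B r (-y) * (1 / ((r + x : ℝ) : ℂ)) =
      ∫ T in Ioi (1 : ℝ), (∫ r in Ioi (0 : ℝ), A r * (1 / ((r + x * T : ℝ) : ℂ))) * B (y * T) := by
  have swap := integral_integral_swap (μ := volume.restrict (Ioi (1 : ℝ)))
    (ν := volume.restrict (Ioi (0 : ℝ)))
    (f := fun T r => A (r * T) * B (y * T) * (1 / ((r + x : ℝ) : ℂ)))
    (integrable_dilation_div hA hB hx hy)
  simp only [dilationKernel, neg_mul, neg_neg, ← integral_mul_const]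
  rw [← swap]
  refine setIntegral_congr_fun measurableSet_Ioi fun T (hT : 1 < T) => ?_
  have hT0 : 0 < T := by linarith
  have hTc : (T : ℂ) ≠ 0 := by exact_mod_cast hT0.ne'
  have h := integral_comp_mul_right_Ioi'
    (fun r => A r * (1 / ((r + x * T : ℝ) : ℂ)) * B (y * T)) 0 hT0
  rw [zero_mul, Complex.real_smul, ← integral_const_mul] at h
  rw [← h]
  refine setIntegral_congr_fun measurableSet_Ioi fun r (hr : 0 < r) => ?_
  have hrx : ((r + x : ℝ) : ℂ) ≠ 0 := by exact_mod_cast (by positivity : r + x ≠ 0)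
  rw [show r * T + x * T = (r + x) * T by ring, Complex.ofReal_mul]
  field_simp

end Kernel

/-! ### Identification of the density of `N` and of the block. -/

section Main

variable {z z' : ℂ}

/-- The density of the product of independent variables with the (complex) gamma density `φ_{z'}`
and beta density `φ_{z,-z-1}`, up to a constant. -/
def densityA (z z' : ℂ) : ℝ → ℂ := (Ioi 0).indicator (convDensity z' z (-z - 1))

/-- The density of the product of independent variables with the (complex) gamma density `φ_{-z'}`
and beta density `φ_{-z,z-1}`, up to a constant. -/
def densityB (z z' : ℂ) : ℝ → ℂ := (Ioi 0).indicator (solPsi z z')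

lemma isHalfLineDensity_densityA (hz : -1 < z.re) (hz0 : z.re < 0) (hz' : -1 < z'.re) :
    IsHalfLineDensity (densityA z z') := by
  have hd : -1 < (-z - 1).re := by simp; linarith
  refine .of_continuousOn (fun x hx => ?_) (integrableOn_convDensity hz' hz hd) fun ε hε =>
    exists_norm_gammaWeight_mul_le z' hε
      (exists_le_mul_exp_of_le_const hε (exists_norm_kummerInt_le hd _ hε))
  exact ((hasDerivAt_gammaWeight z' hx).continuousAt.mul
    (hasDerivAt_kummerInt hd _ hx).continuousAt).continuousWithinAt

lemma isHalfLineDensity_densityB (hz : -1 < z.re) (hz0 : z.re < 0) (hz' : -1 < z'.re)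
    (hz0' : z'.re < 0) : IsHalfLineDensity (densityB z z') :=
  .of_continuousOn (continuousOn_solPsi z z') (integrableOn_solPsi hz hz0 hz' hz0') fun _ hε =>
    exists_norm_solPsi_le hz z' hε

/-- The Stieltjes transform comes out with the roles of `z` and `z'` exchanged; the Kummer
transformation restores the solution that pairs with `solPsi` in the bilinear identity. -/
lemma integral_densityA_div (hz : -1 < z.re) (hz0 : z.re < 0) (hz' : -1 < z'.re) {x : ℝ}
    (hx : 0 < x) :
    ∫ r in Ioi (0 : ℝ), densityA z z' r * (1 / ((r + x : ℝ) : ℂ)) =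
      Complex.Gamma (z + 1) * Complex.Gamma (-z) * Complex.Gamma (z' + 1) * solPhi z z' x := by
  have hG : Complex.Gamma (z' + 1) ≠ 0 := Complex.Gamma_ne_zero_of_re_pos (by simp; linarith)
  have h1 : ∫ r in Ioi (0 : ℝ), densityA z z' r * (1 / ((r + x : ℝ) : ℂ)) =
      ∫ r in Ioi (0 : ℝ), convDensity z' z (-z - 1) r * (1 / ((r + x : ℝ) : ℂ)) :=
    setIntegral_congr_fun measurableSet_Ioi fun r hr => by
      simp only [densityA, indicator_of_mem hr]
  rw [h1, integral_convDensity_div hz hz0 hz' hx, solPhi, cpow_mul_kummerReg_symm z z' hx,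
    kummerReg_of_neg_one_lt hz']
  field_simp

/-- The density of the generalized function `N`. -/
def kernelN (z z' : ℂ) (x y : ℝ) : ℂ :=
  1 / (Complex.Gamma (-z) * Complex.Gamma (-z')) *
    (Complex.Gamma (z + 1) * Complex.Gamma (-z) * Complex.Gamma (z' + 1))⁻¹ *
    dilationKernel (densityA z z') (densityB z z') x y

lemma representsN_kernelN (hz : -1 < z.re) (hz0 : z.re < 0) (hz' : -1 < z'.re) (hz0' : z'.re < 0) :
    RepresentsN z z' (kernelN z z') where
  integrable := (integrable_dilationKernel (isHalfLineDensity_densityA hz hz0 hz')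
    (isHalfLineDensity_densityB hz hz0 hz' hz0')).const_mul _
  continuousOn := continuousOn_const.mul (continuousOn_dilationKernel
    (isHalfLineDensity_densityA hz hz0 hz') (isHalfLineDensity_densityB hz hz0 hz' hz0'))
  eq_zero x y h := by
    rw [kernelN, dilationKernel_eq_zero (isHalfLineDensity_densityA hz hz0 hz')
      (isHalfLineDensity_densityB hz hz0 hz' hz0') x y h, mul_zero]
  eq_integral f hf hfs := by
    obtain ⟨M, hM⟩ := hf.continuous.bounded_above_of_compact_support hfs
    have hne : ∀ {s : ℂ}, 0 < s.re → s ≠ 0 := fun h h0 => by simp [h0] at h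
    have g1 : Complex.Gamma (z + 1) ≠ 0 := Complex.Gamma_ne_zero_of_re_pos (by simp; linarith)
    have g2 : Complex.Gamma (-z) ≠ 0 := Complex.Gamma_ne_zero_of_re_pos (by simp; linarith)
    have g3 : Complex.Gamma (-z') ≠ 0 := Complex.Gamma_ne_zero_of_re_pos (by simp; linarith)
    have g4 : Complex.Gamma (z' + 1) ≠ 0 := Complex.Gamma_ne_zero_of_re_pos (by simp; linarith)
    have hnz : -z ≠ 0 := hne (by simp; linarith)
    have hnz' : -z' ≠ 0 := hne (by simp; linarith)
    have hz1 : z ≠ 0 := neg_ne_zero.1 hnz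
    have hz1' : z' ≠ 0 := neg_ne_zero.1 hnz'
    simp only [kernelN, mul_assoc (1 / (Complex.Gamma (-z) * Complex.Gamma (-z')) *
      (Complex.Gamma (z + 1) * Complex.Gamma (-z) * Complex.Gamma (z' + 1))⁻¹)]
    rw [integral_const_mul, integral_dilationKernel_mul (isHalfLineDensity_densityA hz hz0 hz')
      (isHalfLineDensity_densityB hz hz0 hz' hz0') hf.continuous hM, genN_eq hf hfs hz hz0 hz' hz0']
    have hB : ∀ x, ∫ y, densityB z z' y * segAvg f x y =
        ∫ y in Ioi (0 : ℝ), solPsi z z' y * segAvg f x y := fun x => by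
      simp only [densityB, ← indicator_mul_left]
      exact integral_indicator measurableSet_Ioi
    have hA : ∀ h : ℝ → ℂ, ∫ x, densityA z z' x * h x =
        ∫ x in Ioi (0 : ℝ), convDensity z' z (-z - 1) x * h x := fun h => by
      simp only [densityA, ← indicator_mul_left]
      exact integral_indicator measurableSet_Ioi
    simp only [hB, hA, convDensity_eq_solF hz, mul_assoc (Complex.Gamma (z + 1)) (solF z z' _),
      integral_const_mul, integral_solF_segAvg hz hz0 hz' hz0' hf hfs]
    simp only [mul_left_comm (convDensity z' z (-z - 1) _), integral_const_mul]
    -- The factor `t = zz'` is absorbed by `Γ(1-z) = -zΓ(-z)` and `Γ(1-z') = -z'Γ(-z')`.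
    rw [show 1 - z' = -z' + 1 by ring, show 1 - z = -z + 1 by ring, show 1 + z = z + 1 by ring,
      Complex.Gamma_add_one _ hnz, Complex.Gamma_add_one _ hnz']
    field_simp

lemma integrableOn_kernelN_div (hz : -1 < z.re) (hz0 : z.re < 0) (hz' : -1 < z'.re)
    (hz0' : z'.re < 0) {x y : ℝ} (hx : 0 < x) (hy : 0 < y) :
    IntegrableOn (fun r : ℝ => kernelN z z' r (-y) / ((r : ℂ) + x)) (Ioi 0) := by
  have h := (integrableOn_dilationKernel_div (isHalfLineDensity_densityA hz hz0 hz')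
    (isHalfLineDensity_densityB hz hz0 hz' hz0') hx hy).const_mul
    (1 / (Complex.Gamma (-z) * Complex.Gamma (-z')) *
    (Complex.Gamma (z + 1) * Complex.Gamma (-z) * Complex.Gamma (z' + 1))⁻¹)
  refine h.congr (Eventually.of_forall fun r => ?_)
  simp only [kernelN, Complex.ofReal_add]
  ring

lemma integral_kernelN_div (hz : -1 < z.re) (hz0 : z.re < 0) (hz' : -1 < z'.re)
    (hz0' : z'.re < 0) {x y : ℝ} (hx : 0 < x) (hy : 0 < y) :
    ∫ r in Ioi (0 : ℝ), kernelN z z' r (-y) / ((r : ℂ) + x) =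
      1 / (Complex.Gamma (-z) * Complex.Gamma (-z')) *
        ∫ T in Ioi (1 : ℝ), solPhi z z' (x * T) * solPsi z z' (y * T) := by
  have g1 : Complex.Gamma (z + 1) ≠ 0 := Complex.Gamma_ne_zero_of_re_pos (by simp; linarith)
  have g2 : Complex.Gamma (-z) ≠ 0 := Complex.Gamma_ne_zero_of_re_pos (by simp; linarith)
  have g4 : Complex.Gamma (z' + 1) ≠ 0 := Complex.Gamma_ne_zero_of_re_pos (by simp; linarith)
  have e : ∀ r : ℝ, kernelN z z' r (-y) / ((r : ℂ) + x) =
      1 / (Complex.Gamma (-z) * Complex.Gamma (-z')) *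
        (Complex.Gamma (z + 1) * Complex.Gamma (-z) * Complex.Gamma (z' + 1))⁻¹ *
        (dilationKernel (densityA z z') (densityB z z') r (-y) * (1 / ((r + x : ℝ) : ℂ))) := by
    intro r
    simp only [kernelN, Complex.ofReal_add]
    ring
  simp only [e]
  rw [integral_const_mul, integral_dilationKernel_div (isHalfLineDensity_densityA hz hz0 hz')
    (isHalfLineDensity_densityB hz hz0 hz' hz0') hx hy, mul_assoc, ← integral_const_mul]
  congr 1
  refine setIntegral_congr_fun measurableSet_Ioi fun T (hT : 1 < T) => ?_
  have hT0 : 0 < T := by linarith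
  have hyT : y * T ∈ Ioi (0 : ℝ) := mul_pos hy hT0
  rw [integral_densityA_div hz hz0 hz' (mul_pos hx hT0), densityB, indicator_of_mem hyT]
  field_simp

lemma blockMM_eq (n : ℝ → ℝ → ℂ) {x : ℝ} (hx : 0 < x) (y : ℝ) :
    blockMM n x y = ∫ r in Ioi (0 : ℝ), n r (-y) / ((r : ℂ) + x) := by
  rw [blockMM, ← integral_indicator measurableSet_Ioi]
  congr 1
  ext r
  by_cases hr : 0 < r
  · rw [indicator_of_mem (mem_Ioi.2 hr), w, if_pos ⟨neg_lt_zero.2 hx, hr⟩, abs_neg, abs_of_pos hx,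
      add_comm x r]
    push_cast
    ring
  · rw [indicator_of_notMem (by simpa using hr), w, if_neg (fun h => hr h.2)]
    simp

end Main

end WhittakerKernel

end
open WhittakerKernel in
theorem corollary2p3 :
    (∀ z z' : ℂ, -1 < z.re → z.re < 0 → -1 < z'.re → z'.re < 0 →
      ∃ n : ℝ → ℝ → ℂ, RepresentsN z z' n ∧
        ∀ x : ℝ, 0 < x →
          (∀ y : ℝ, 0 < y →
            IntegrableOn (fun r : ℝ => n r (-y) / ((r : ℂ) + x)) (Ioi 0) ∧
            blockMM n x y = ∫ r in Ioi (0 : ℝ), n r (-y) / ((r : ℂ) + x)) ∧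
          ∀ s : Fin 4 → ℤˣ,
            (∀ y : ℝ, 0 < y → x ≠ y → blockMM n x y = formulaMM s z z' x y) ∧
            Tendsto (fun y : ℝ => formulaMM s z z' x y) (𝓝[≠] x) (𝓝 (blockMM n x x))) ∧
    (∀ s : Fin 4 → ℤˣ, ∀ x y : ℝ, 0 < x → 0 < y → x ≠ y →
      Differentiable ℂ (fun p : ℂ × ℂ => formulaMM s p.1 p.2 x y)) := by
  refine ⟨fun z z' hz hz0 hz' hz0' => ⟨kernelN z z', representsN_kernelN hz hz0 hz' hz0',
    fun x hx => ⟨fun y hy => ⟨integrableOn_kernelN_div hz hz0 hz' hz0' hx hy, blockMM_eq _ hx y⟩,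
      fun s => ?_⟩⟩, fun s x y hx hy _ => differentiable_formulaMM s hx hy⟩
  have hblock : ∀ y : ℝ, 0 < y → blockMM (kernelN z z') x y =
      1 / (Complex.Gamma (-z) * Complex.Gamma (-z')) *
        ∫ T in Ioi (1 : ℝ), solPhi z z' (x * T) * solPsi z z' (y * T) := fun y hy => by
    rw [blockMM_eq _ hx, integral_kernelN_div hz hz0 hz' hz0' hx hy]
  have hformula : ∀ y : ℝ, 0 < y → x ≠ y →
      blockMM (kernelN z z') x y = formulaMM s z z' x y := fun y hy hxy => by
    rw [hblock y hy, formulaMM_eq s z z' hx hy, integral_solPhi_solPsi hz z' hx hy hxy]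
  refine ⟨hformula, ?_⟩
  -- The integral over `T` agrees with the closed formula off the diagonal and is continuous across
  -- it, so its value at `y = x` is the required limit.
  have hcont := (continuousAt_integral_solPhi_solPsi hz z' hx hx).const_mul
    (1 / (Complex.Gamma (-z) * Complex.Gamma (-z')))
  rw [hblock x hx]
  refine (hcont.tendsto.mono_left nhdsWithin_le_nhds).congr' ?_
  filter_upwards [self_mem_nhdsWithin, nhdsWithin_le_nhds (Ioi_mem_nhds hx)] with y hy hy0
  rw [← hformula y hy0 (Ne.symm hy), hblock y hy0]
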